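/- Let $\mathcal H_{A_1},\dots,\mathcal H_{A_m}$ be separable complex Hilbert spaces (finite- or infinite-dimensional) and let $\rho_{A_1\cdots A_m}$ be a density operator (positive, trace one) on $\mathcal H_{A_1}\otimes\cdots\otimes\mathcal H_{A_m}$. Then $$E_{\mathrm{sq}}(A_1;\cdots;A_m)_\rho=\widetilde E_{\mathrm{sq}}(A_1;\cdots;A_m)_\rho$$ as elements of $[0,\infty]$, where $$E_{\mathrm{sq}}(A_1;\cdots;A_m)_\rho=\tfrac12\inf_{\omega}\ \sum_{i=2}^m I(A_i;A_1\cdots A_{i-1}\,|\,E)_\omega ,\qquad \widetilde E_{\mathrm{sq}}(A_1;\cdots;A_m)_\rho=\tfrac12\inf_{\omega}\ \sum_{i=2}^m I(A_i;A_1\cdots A_{i-1}\,|\,A_{i+1}\cdots A_mE)_\omega ,$$ and both infima are over all density operators $\omega_{A_1\cdots A_mE}$, with $\mathcal H_E$ an arbitrary separable Hilbert space, such that $\operatorname{Tr}_E\,\omega_{A_1\cdots A_mE}=\rho_{A_1\cdots A_m}$. (The first sum is the conditional total correlation $I(A_1;\cdots;A_m|E)_\omega$, the second the conditional dual total correlation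 $\widetilde I(A_1;\cdots;A_m|E)_\omega$.) Here, for states $\rho=\sum_ip(i)|\phi_i\rangle\langle\phi_i|$ and $\sigma=\sum_jq(j)|\psi_j\rangle\langle\psi_j|$ (spectral decompositions in orthonormal bases), the relative entropy is $$D(\rho\|\sigma)=\frac1{\ln2}\sum_{i,j}|\langle\phi_i|\psi_j\rangle|^2\Big[p(i)\ln\frac{p(i)}{q(j)}+q(j)-p(i)\Big]\in[0,\infty],$$ with $0\ln0=0\ln\frac00=0$ and $\ln\frac c0=+\infty$ for $c>0$. The mutual information of a state is $I(A;B)_\tau=D(\tau_{AB}\|\tau_A\otimes\tau_B)$; for a nonzero positive trace-class operator $\tau$ it is $I(A;B)_\tau=\operatorname{Tr}\{\tau\}\,I(A;B)_{\tau/\operatorname{Tr}\{\tau\}}$, and it is $0$ for $\tau=0$. The conditional mutual information of a state $\omega_{ABE}$ is $$I(A;B|E)_\omega=\sup_{P_A}\big[I(A;BE)_{Q_A\omega Q_A}-I(A;E)_{Q_A\omega Q_A}\big]\in[0,\infty],\qquad Q_A=P_A\otimes I_{BE},$$ the supremum being over all finite-rank orthogonal projections $P_A$ on $\mathcal H_A$.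 -/

import Mathlib

open scoped InnerProductSpace ENNReal

noncomputable section

namespace QuantumInfo

/-! ### Coordinate Hilbert spaces

Every separable Hilbert space is unitarily equivalent to `ℓ²(ι)` for a countable `ι`, and the Hilbert
tensor product of `ℓ²(α)` and `ℓ²(β)` is `ℓ²(α × β)`, with `e_a ⊗ e_b = e_(a,b)`. -/

/-- The Hilbert space `ℓ²(ι)` of square-summable complex families. -/
abbrev L2 (ι : Type*) := lp (fun _ : ι => ℂ) 2

/-- The standard orthonormal basis of `ℓ²(ι)`. -/
def ket {ι : Type*} : HilbertBasis ι ℂ (L2 ι) := ⟨LinearIsometryEquiv.refl ℂ (L2 ι)⟩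

/-- The isometry `ℓ²(α) → ℓ²(β)`, `e_a ↦ e_(f a)`, of an injective map `f : α → β`. -/
def embed {α β : Type*} (f : α ↪ β) : L2 α →ₗᵢ[ℂ] L2 β :=
  ((ket (ι := β)).orthonormal.comp f f.injective).orthogonalFamily.linearIsometry

/-- The isometry `x ↦ x ⊗ e_b`. -/
def tensorKet {α β : Type*} (b : β) : L2 α →ₗᵢ[ℂ] L2 (α × β) :=
  embed ⟨fun a => (a, b), fun _ _ h => (Prod.ext_iff.mp h).1⟩

lemma embed_ket {α β : Type*} (f : α ↪ β) (a : α) : embed f (ket a) = ket (f a) := by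
  classical
  have h : (ket a : L2 α) = lp.single 2 a (1 : ℂ) := ((ket (ι := α)).repr_symm_single a).symm
  rw [h, embed, OrthogonalFamily.linearIsometry_apply_single]
  simp

lemma inner_embed_of_disjoint {α β : Type*} (f g : α ↪ β) (h : ∀ a a', f a ≠ g a') (x y : L2 α) :
    ⟪embed f x, embed g y⟫_ℂ = 0 := by
  have hx := ((ket (ι := β)).orthonormal.comp f f.injective).orthogonalFamily.hasSum_linearIsometry x
  have hy := ((ket (ι := β)).orthonormal.comp g g.injective).orthogonalFamily.hasSum_linearIsometry y
  have key : ∀ a, ⟪(ket (f a) : L2 β), embed g y⟫_ℂ = 0 := fun a => by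
    refine (hy.mapL (innerSL ℂ (ket (f a) : L2 β))).unique ?_
    convert hasSum_zero using 2 with a'
    simp [(ket (ι := β)).orthonormal.2 (h a a')]
  rw [← inner_conj_symm, map_eq_zero]
  refine (hx.mapL (innerSL ℂ (embed g y))).unique ?_
  convert hasSum_zero using 2 with a
  have := key a
  rw [← inner_conj_symm, map_eq_zero] at this
  simp [this]

lemma orthogonalFamily_tensorKet (α β : Type*) :
    OrthogonalFamily ℂ (fun _ : β => L2 α) (fun b => tensorKet (α := α) b) := by
  intro b b' hb x y
  exact inner_embed_of_disjoint _ _ (fun a a' h => hb (Prod.ext_iff.mp h).2) x y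

/-- The unitary `ℓ²(β; ℓ²(α)) → ℓ²(α × β)`, `(x_b)_b ↦ ∑_b x_b ⊗ e_b`. -/
def directSumIso (α β : Type*) : lp (fun _ : β => L2 α) 2 →ₗᵢ[ℂ] L2 (α × β) :=
  (orthogonalFamily_tensorKet α β).linearIsometry

/-- Relabelling of the basis by a bijection (for example a permutation of tensor factors):
`ρ ↦ U ρ U†` with the unitary `U e_a = e_(e a)`. -/
def reindexOp {α β : Type*} (e : α ≃ β) (ρ : L2 α →L[ℂ] L2 α) : L2 β →L[ℂ] L2 β :=
  (embed e.toEmbedding).toContinuousLinearMap ∘L ρ ∘L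
    (embed e.toEmbedding).toContinuousLinearMap.adjoint

/-- The ampliation `S ⊗ 1` on `ℓ²(α × β)` of a bounded operator `S` on `ℓ²(α)`. -/
def leftOp {α : Type*} (β : Type*) (S : L2 α →L[ℂ] L2 α) : L2 (α × β) →L[ℂ] L2 (α × β) :=
  (directSumIso α β).toContinuousLinearMap ∘L
    lp.mapCLM 2 (fun _ : β => S) (norm_nonneg S) (fun _ => le_rfl) ∘L
      (directSumIso α β).toContinuousLinearMap.adjoint

/-- The tensor product `S ⊗ T = (S ⊗ 1) (1 ⊗ T)` of bounded operators. -/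
def tensorOp {α β : Type*} (S : L2 α →L[ℂ] L2 α) (T : L2 β →L[ℂ] L2 β) :
    L2 (α × β) →L[ℂ] L2 (α × β) :=
  leftOp β S ∘L reindexOp (Equiv.prodComm β α) (leftOp α T)

/-! ### States, partial trace -/

/-- Density operators: positive (hence self-adjoint) bounded operators of trace one, the trace being
computed in any orthonormal basis. -/
def IsDensityOperator {K : Type*} [NormedAddCommGroup K] [InnerProductSpace ℂ K]
    (ρ : K →L[ℂ] K) : Prop :=
  ρ.IsPositive ∧
    ∀ (w : Set K) (b : HilbertBasis w ℂ K), HasSum (fun i => ⟪b i, ρ (b i)⟫_ℂ) 1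

/-- Partial trace over the second factor, `∑_b (1 ⊗ ⟨b|) ρ (1 ⊗ |b⟩)`; for a positive trace-class
`ρ` the series converges absolutely. -/
def trRight {α β : Type*} (ρ : L2 (α × β) →L[ℂ] L2 (α × β)) : L2 α →L[ℂ] L2 α :=
  ∑' b : β, (tensorKet b).toContinuousLinearMap.adjoint ∘L ρ ∘L (tensorKet b).toContinuousLinearMap

/-- Partial trace over the first factor. -/
def trLeft {α β : Type*} (ρ : L2 (α × β) →L[ℂ] L2 (α × β)) : L2 β →L[ℂ] L2 β :=
  trRight (reindexOp (Equiv.prodComm α β) ρ)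

/-- The trace of a positive trace-class operator on `ℓ²(α)`. -/
def trace {α : Type*} (ρ : L2 α →L[ℂ] L2 α) : ℝ :=
  ∑' a, (⟪(ket a : L2 α), ρ (ket a)⟫_ℂ).re

/-! ### Entropic quantities -/

/-- A spectral decomposition `T = ∑_i p(i) |φ_i⟩⟨φ_i|` with `(φ_i)` an orthonormal basis. -/
structure SpectralDecomposition {α : Type*} (T : L2 α →L[ℂ] L2 α) where
  /-- the orthonormal eigenbasis -/
  vec : HilbertBasis α ℂ (L2 α)
  /-- the eigenvalues -/
  val : α → ℝ
  apply_vec : ∀ i, T (vec i) = (val i : ℂ) • vec i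

/-- `[ln 2]⁻¹ (p ln (p/q) + q - p)` in `[0, ∞]` for `p, q ≥ 0`, with `0 ln (0/q) = 0` and
`ln (p/0) = ∞` for `p > 0`. -/
def relEntropyTerm (p q : ℝ) : ℝ≥0∞ :=
  if q = 0 then (if p = 0 then 0 else ⊤)
  else ENNReal.ofReal ((p * Real.log (p / q) + q - p) / Real.log 2)

/-- Quantum relative entropy in bits,
`D(ρ‖σ) = [ln 2]⁻¹ ∑_{i,j} |⟨φ_i|ψ_j⟩|² (p(i) ln (p(i)/q(j)) + q(j) - p(i))`
for spectral decompositions of `ρ` and `σ`. For density operators such decompositions exist and the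
sum does not depend on which are used, so that the infimum is over a single value. -/
def relEntropy {α : Type*} (ρ σ : L2 α →L[ℂ] L2 α) : ℝ≥0∞ :=
  ⨅ (d : SpectralDecomposition ρ) (d' : SpectralDecomposition σ),
    ∑' (i : α) (j : α),
      ENNReal.ofReal (‖⟪d.vec i, d'.vec j⟫_ℂ‖ ^ 2) * relEntropyTerm (d.val i) (d'.val j)

/-- Quantum mutual information `I(A;B)_ω` of a positive trace-class operator on `A ⊗ B`: for a state
it is `D(ω‖ω_A ⊗ ω_B)`; in general it is `Tr ω · I(A;B)_{ω / Tr ω}` (and `0` for `ω = 0`). -/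
def mutualInfo {α β : Type*} (ω : L2 (α × β) →L[ℂ] L2 (α × β)) : ℝ≥0∞ :=
  let τ := ((trace ω)⁻¹ : ℂ) • ω
  ENNReal.ofReal (trace ω) * relEntropy τ (tensorOp (trRight τ) (trLeft τ))

/-- The marginal on `A ⊗ E` of an operator on `A ⊗ B ⊗ E`. -/
def trMiddle {α β ε : Type*} (ω : L2 (α × β × ε) →L[ℂ] L2 (α × β × ε)) :
    L2 (α × ε) →L[ℂ] L2 (α × ε) :=
  trRight (reindexOp
    (((Equiv.refl α).prodCongr (Equiv.prodComm β ε)).trans (Equiv.prodAssoc α ε β).symm) ω)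

/-- Conditional quantum mutual information of an operator on `A ⊗ B ⊗ E`,
`I(A;B|E)_ω = sup_P [I(A;BE)_{QωQ} - I(A;E)_{QωQ}]`, where `P` runs over the finite-rank orthogonal
projections on `A` and `Q = P ⊗ 1_{BE}`. For a state `ω` both terms are finite, and the difference is
non-negative. -/
def condMutualInfo {α β ε : Type*} (ω : L2 (α × β × ε) →L[ℂ] L2 (α × β × ε)) : ℝ≥0∞ :=
  ⨆ (P : L2 α →L[ℂ] L2 α) (_ : IsStarProjection P) (_ : FiniteDimensional ℂ P.range),
    let Q := leftOp (β × ε) P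
    mutualInfo (Q ∘L ω ∘L Q) - mutualInfo (trMiddle (Q ∘L ω ∘L Q))

/-! ### Multipartite systems `A_1 ⋯ A_m E` -/

section Multipartite

variable {m : ℕ} {ι : Fin m → Type*} {ε : Type*}

/-- The regrouping `A_1 ⋯ A_m E ≃ A_i (A_1 ⋯ A_{i-1}) (A_{i+1} ⋯ A_m) E` of basis labels. -/
def regroup (ι : Fin m → Type*) (ε : Type*) (i : Fin m) :
    ((∀ j, ι j) × ε) ≃
      ι i × (∀ j : {j // j < i}, ι j) × (∀ j : {j // i < j}, ι j) × ε :=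
  Equiv.ofBijective (fun x => (x.1 i, fun j => x.1 j, fun j => x.1 j, x.2)) <| by
    constructor
    · rintro ⟨p, e⟩ ⟨p', e'⟩ h
      simp only [Prod.mk.injEq] at h
      obtain ⟨h1, h2, h3, rfl⟩ := h
      refine Prod.ext (funext fun j => ?_) rfl
      rcases lt_trichotomy j i with hj | rfl | hj
      · exact congrFun h2 ⟨j, hj⟩
      · exact h1
      · exact congrFun h3 ⟨j, hj⟩
    · rintro ⟨a, l, r, e⟩
      refine ⟨(fun j => if hl : j < i then l ⟨j, hl⟩ else if hr : i < j then r ⟨j, hr⟩ else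
        (le_antisymm (not_lt.mp hl) (not_lt.mp hr) : i = j) ▸ a, e), ?_⟩
      refine Prod.ext ?_ (Prod.ext ?_ (Prod.ext ?_ rfl))
      · simp
      · funext j
        simp [j.2]
      · funext j
        simp [j.2, not_lt.mpr j.2.le]

/-- `I(A_i; A_1^{i-1} | A_{i+1}^m E)_ω`. -/
def dualTerm (ω : L2 ((∀ j, ι j) × ε) →L[ℂ] L2 ((∀ j, ι j) × ε)) (i : Fin m) : ℝ≥0∞ :=
  condMutualInfo (ε := (∀ j : {j // i < j}, ι j) × ε) (reindexOp (regroup ι ε i) ω)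

/-- Moves the third factor to the end: `A B C E ≃ (A B E) C`. -/
def moveToEnd (α β γ ε : Type*) : (α × β × γ × ε) ≃ (α × β × ε) × γ where
  toFun x := ((x.1, x.2.1, x.2.2.2), x.2.2.1)
  invFun x := (x.1.1, x.1.2.1, x.2, x.1.2.2)
  left_inv _ := rfl
  right_inv _ := rfl

/-- `I(A_i; A_1^{i-1} | E)_ω`, computed in the marginal of `ω` on `A_1 ⋯ A_i E`. -/
def totalTerm (ω : L2 ((∀ j, ι j) × ε) →L[ℂ] L2 ((∀ j, ι j) × ε)) (i : Fin m) : ℝ≥0∞ :=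
  condMutualInfo (trRight (reindexOp ((regroup ι ε i).trans (moveToEnd _ _ _ _)) ω))

/-- Conditional total correlation `I(A_1;⋯;A_m|E) = ∑_{i=2}^m I(A_i; A_1^{i-1} | E)`
(with `Fin m` counted from `0`, the sum is over the nonzero indices). -/
def condTotalCorrelation (ω : L2 ((∀ j, ι j) × ε) →L[ℂ] L2 ((∀ j, ι j) × ε)) : ℝ≥0∞ :=
  ∑ i ∈ Finset.univ.filter (fun i : Fin m => 0 < (i : ℕ)), totalTerm ω i

/-- Conditional dual total correlation
`Ĩ(A_1;⋯;A_m|E) = ∑_{i=2}^m I(A_i; A_1^{i-1} | A_{i+1}^m E)`. -/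
def condDualTotalCorrelation (ω : L2 ((∀ j, ι j) × ε) →L[ℂ] L2 ((∀ j, ι j) × ε)) : ℝ≥0∞ :=
  ∑ i ∈ Finset.univ.filter (fun i : Fin m => 0 < (i : ℕ)), dualTerm ω i

/-- `ω` on `A_1 ⋯ A_m E`, with `E = ℓ²(ε)`, is an extension of `ρ` on `A_1 ⋯ A_m`. -/
def IsExtension (ρ : L2 (∀ j, ι j) →L[ℂ] L2 (∀ j, ι j))
    (ω : L2 ((∀ j, ι j) × ε) →L[ℂ] L2 ((∀ j, ι j) × ε)) : Prop :=
  IsDensityOperator ω ∧ trRight ω = ρ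

end Multipartite

/-! ### Arbitrary Hilbert spaces -/

section Abstract

variable {m : ℕ} {H : Fin m → Type*} [∀ i, NormedAddCommGroup (H i)]
  [∀ i, InnerProductSpace ℂ (H i)]
  {K : Type*} [NormedAddCommGroup K] [InnerProductSpace ℂ K]

/-- `K`, with the multilinear map `t = ((x_i)_i ↦ x_1 ⊗ ⋯ ⊗ x_m)`, is the Hilbert space tensor
product of the `H i`. -/
structure IsHilbertTensorProduct (t : MultilinearMap ℂ H K) : Prop where
  inner_map : ∀ x y, ⟪t x, t y⟫_ℂ = ∏ i, ⟪x i, y i⟫_ℂ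
  dense : (Submodule.span ℂ (Set.range t)).topologicalClosure = ⊤

/-- The labels of a fixed orthonormal basis of a Hilbert space. -/
def BasisIndex (E : Type*) [NormedAddCommGroup E] [InnerProductSpace ℂ E] [CompleteSpace E] :
    Set E :=
  (exists_hilbertBasis ℂ E).choose

/-- A fixed orthonormal basis of a Hilbert space. -/
def fixedBasis (E : Type*) [NormedAddCommGroup E] [InnerProductSpace ℂ E] [CompleteSpace E] :
    HilbertBasis (BasisIndex E) ℂ E :=
  (exists_hilbertBasis ℂ E).choose_spec.choose

namespace IsHilbertTensorProduct

variable {t : MultilinearMap ℂ H K}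

lemma norm_map (ht : IsHilbertTensorProduct t) (x : ∀ i, H i) : ‖t x‖ = ∏ i, ‖x i‖ := by
  have h : ((‖t x‖ : ℂ)) ^ 2 = ((∏ i, ‖x i‖ : ℝ) : ℂ) ^ 2 := by
    have h1 := ht.inner_map x x
    simp only [inner_self_eq_norm_sq_to_K] at h1
    rw [Finset.prod_pow] at h1
    simpa using h1
  have h' : ‖t x‖ ^ 2 = (∏ i, ‖x i‖) ^ 2 := by exact_mod_cast h
  exact (sq_eq_sq₀ (norm_nonneg _) (Finset.prod_nonneg fun i _ => norm_nonneg _)).mp h'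

variable [∀ i, CompleteSpace (H i)]

lemma orthonormal (ht : IsHilbertTensorProduct t) :
    Orthonormal ℂ (fun p : ∀ i, BasisIndex (H i) => t fun i => fixedBasis (H i) (p i)) := by
  classical
  rw [orthonormal_iff_ite]
  intro p q
  rw [ht.inner_map]
  split_ifs with h
  · subst h
    exact Finset.prod_eq_one fun i _ => by
      simp [inner_self_eq_norm_sq_to_K, (fixedBasis (H i)).orthonormal.1]
  · obtain ⟨i, hi⟩ := Function.ne_iff.mp h
    exact Finset.prod_eq_zero (Finset.mem_univ i) ((fixedBasis (H i)).orthonormal.2 hi)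

lemma orthogonal_eq_bot (ht : IsHilbertTensorProduct t) :
    (Submodule.span ℂ (Set.range fun p : ∀ i, BasisIndex (H i) =>
      t fun i => fixedBasis (H i) (p i)))ᗮ = ⊥ := by
  classical
  rw [Submodule.eq_bot_iff]
  intro v hv
  let c : ContinuousMultilinearMap ℂ H K :=
    t.mkContinuous 1 fun x => by rw [ht.norm_map, one_mul]
  have hc : ∀ x, c x = t x := fun _ => rfl
  have key : ∀ S : Finset (Fin m), ∀ x : ∀ i, H i,
      (∀ i ∉ S, x i ∈ Set.range (fixedBasis (H i))) → ⟪v, t x⟫_ℂ = 0 := by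
    intro S
    induction S using Finset.induction_on with
    | empty =>
      intro x hx
      choose p hp using fun i => hx i (Finset.notMem_empty i)
      have hx' : x = fun i => fixedBasis (H i) (p i) := funext fun i => (hp i).symm
      rw [hx', ← inner_conj_symm, map_eq_zero]
      exact hv _ (Submodule.subset_span ⟨p, rfl⟩)
    | insert i S hi ih =>
      intro x hx
      let L : H i →L[ℂ] ℂ := (innerSL ℂ v) ∘L c.toContinuousLinearMap x i
      have hL : L = 0 := by
        refine ContinuousLinearMap.ext_on
          (s := Set.range (fixedBasis (H i))) ?_ ?_
        · exact Submodule.dense_iff_topologicalClosure_eq_top.mpr (fixedBasis (H i)).dense_span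
        · rintro _ ⟨k, rfl⟩
          change ⟪v, t (Function.update x i (fixedBasis (H i) k))⟫_ℂ = 0
          refine ih _ fun j hj => ?_
          by_cases hji : j = i
          · subst hji
            simp
          · rw [Function.update_of_ne hji]
            exact hx j (by simp [hji, hj])
      have := congrArg (fun M : H i →L[ℂ] ℂ => M (x i)) hL
      change ⟪v, t (Function.update x i (x i))⟫_ℂ = 0 at this
      rwa [Function.update_eq_self] at this
  have hz : ∀ y : K, ⟪v, y⟫_ℂ = 0 := by
    have : innerSL ℂ v = 0 := by
      refine ContinuousLinearMap.ext_on (s := Set.range t)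
        (Submodule.dense_iff_topologicalClosure_eq_top.mpr ht.dense) ?_
      rintro _ ⟨x, rfl⟩
      exact key Finset.univ x (by simp)
    intro y
    exact congrArg (fun M : K →L[ℂ] ℂ => M y) this
  exact inner_self_eq_zero.mp (hz v)

variable [CompleteSpace K]

/-- The orthonormal basis of `K` formed by the tensor products of basis vectors of the `H i`. -/
def productBasis (ht : IsHilbertTensorProduct t) :
    HilbertBasis (∀ i, BasisIndex (H i)) ℂ K :=
  HilbertBasis.mkOfOrthogonalEqBot ht.orthonormal ht.orthogonal_eq_bot

/-- An operator on `K` in the coordinates of the product basis. (Another choice of the bases of the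
`H i` changes it by a local unitary, to which none of the quantities below is sensitive.) -/
def toCoordinates (ht : IsHilbertTensorProduct t) (ρ : K →L[ℂ] K) :
    L2 (∀ i, BasisIndex (H i)) →L[ℂ] L2 (∀ i, BasisIndex (H i)) :=
  (ht.productBasis.repr : K →L[ℂ] L2 (∀ i, BasisIndex (H i))) ∘L ρ ∘L
    (ht.productBasis.repr.symm : L2 (∀ i, BasisIndex (H i)) →L[ℂ] K)

end IsHilbertTensorProduct

variable [∀ i, CompleteSpace (H i)] [CompleteSpace K] {t : MultilinearMap ℂ H K}

/-- The multipartite squashed entanglement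
`E_sq(A_1;⋯;A_m)_ρ = ½ inf I(A_1;⋯;A_m|E)_ω`, the infimum being over all separable Hilbert spaces
`E = ℓ²(ε)` and all states `ω` on `A_1 ⋯ A_m E` that extend `ρ`. -/
def squashedEntanglement (ht : IsHilbertTensorProduct t) (ρ : K →L[ℂ] K) : ℝ≥0∞ :=
  (1 / 2) * ⨅ (ε : Type) (_ : Countable ε)
    (ω : L2 ((∀ i, BasisIndex (H i)) × ε) →L[ℂ] L2 ((∀ i, BasisIndex (H i)) × ε))
    (_ : IsExtension (ht.toCoordinates ρ) ω), condTotalCorrelation ω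

/-- The multipartite squashed entanglement
`Ẽ_sq(A_1;⋯;A_m)_ρ = ½ inf Ĩ(A_1;⋯;A_m|E)_ω` based on the conditional dual total correlation. -/
def dualSquashedEntanglement (ht : IsHilbertTensorProduct t) (ρ : K →L[ℂ] K) : ℝ≥0∞ :=
  (1 / 2) * ⨅ (ε : Type) (_ : Countable ε)
    (ω : L2 ((∀ i, BasisIndex (H i)) × ε) →L[ℂ] L2 ((∀ i, BasisIndex (H i)) × ε))
    (_ : IsExtension (ht.toCoordinates ρ) ω), condDualTotalCorrelation ω

end Abstract

end QuantumInfo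

end

/-!
The two infima agree because every extension `ω` of `ρ` has a complementary extension `ω'` whose dual
total correlation is the total correlation of `ω`, and conversely. Let `ψ` on `A_1 ⋯ A_m E F` purify
`ω` (`IsDensityOperator.exists_marg_eq`), and let `ω'` be the marginal of `ψ` on `A_1 ⋯ A_m F`. It
extends `ρ` as well, and the two total correlations agree term by term (`totalTerm_marg`), by the
duality `I(A;B|E) = I(A;B|F)` of the conditional mutual information in a pure state on `A B E F`
(`condMutualInfo_marg_swapInner`), applied with `A = A_i`, `B = A_1 ⋯ A_{i-1}` and the systems `E` and
`A_{i+1} ⋯ A_m F` to condition on.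

Duality holds for each finite-rank projection `P` in the supremum that defines `I(A;B|E)`. It follows
from the sum rule `I(A;C) + I(A;D) = 2 S(A)` for pure states on `A C D` (`mutualInfo_add_mutualInfo`):
taking `C D` to be `(B E) F` and `(B F) E`,
`I(A;BE) + I(A;F) = 2 S(A) = I(A;BF) + I(A;E)`, where `S(A)` is finite because of `P`
(`vonNeumannEntropy_ne_top`), so that the terms can be moved across. No inequality between entropies
is involved.

In infinite dimensions `S(C)` and `S(D)` may be infinite, so the sum rule is proved without them. Let
`a_k`, `c_l`, `p_i` be the eigenvalues of the marginals on `A`, `C`, `D`, and let `t_kli` be the squared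
modulus of the coefficients of `ψ` in the product of the eigenbases. By the Schmidt decomposition
(`exists_schmidt`) the eigenbasis of `ρ_D` determines one of `ρ_AC`, in which the terms of
`D(ρ_AC‖ρ_A ⊗ ρ_C)` are `t_kli ln (p_i / (a_k c_l))`, up to corrections that make them nonnegative
and sum to zero (`exists_relEntropy_eq`). Those of `D(ρ_AD‖ρ_A ⊗ ρ_D)` are `t_kli ln (c_l / (a_k p_i))`, and the
logarithms of `p_i` and `c_l` cancel in the sum (`relEntropyTerm_add_relEntropyTerm`).

The relative entropy is defined by an infimum over spectral decompositions. That all of them give the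
same value is `relSum_congr`; that marginals have one is the spectral theorem for compact operators
(`nonempty_spectralDecomposition_marg`).
-/

namespace QuantumInfo

/-! ### Coordinates, slices and tensor products of vectors -/

section Coordinates

variable {α β S R : Type*}

lemma ket_inner (a : α) (x : L2 α) : ⟪(ket a : L2 α), x⟫_ℂ = x a := by
  rw [← HilbertBasis.repr_apply_apply]; rfl

/-- A vector is determined by its coordinates. -/
lemma ext_ket {x y : L2 α} (h : ∀ a, ⟪(ket a : L2 α), x⟫_ℂ = ⟪(ket a : L2 α), y⟫_ℂ) : x = y := by
  ext a
  simpa only [ket_inner] using h a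

lemma embed_equiv_apply (e : α ≃ β) (x : L2 α) (b : β) :
    embed e.toEmbedding x b = x (e.symm b) := by
  rw [← ket_inner, ← ket_inner]
  conv_lhs => rw [← e.apply_symm_apply b]
  rw [← e.coe_toEmbedding, ← embed_ket, LinearIsometry.inner_map_map]

lemma adjoint_embed_equiv (e : α ≃ β) :
    (embed e.toEmbedding).toContinuousLinearMap.adjoint
      = (embed e.symm.toEmbedding).toContinuousLinearMap := by
  refine ContinuousLinearMap.ext fun x => ext_ket fun a => ?_
  rw [ContinuousLinearMap.adjoint_inner_right]
  simp [embed_ket, ket_inner, embed_equiv_apply]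

lemma reindexOp_apply (e : α ≃ β) (T : L2 α →L[ℂ] L2 α) (x : L2 β) :
    reindexOp e T x = embed e.toEmbedding (T (embed e.symm.toEmbedding x)) := by
  simp [reindexOp, adjoint_embed_equiv]

/-- The slice `(1 ⊗ ⟨e_r|) ψ` of a bipartite vector. -/
noncomputable def slice (r : R) : L2 (S × R) →L[ℂ] L2 S :=
  (tensorKet r).toContinuousLinearMap.adjoint

lemma slice_apply (r : R) (ψ : L2 (S × R)) (s : S) : slice r ψ s = ψ (s, r) := by
  rw [← ket_inner, slice, ContinuousLinearMap.adjoint_inner_right, ← ket_inner]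
  simp [tensorKet, embed_ket]
  rfl

lemma ext_slice {ψ ψ' : L2 (S × R)} (h : ∀ r, slice r ψ = slice r ψ') : ψ = ψ' := by
  ext ⟨s, r⟩
  rw [← slice_apply, ← slice_apply, h]

/-- In coordinates `directSumIso` is uncurrying, and its adjoint takes slices. -/
lemma directSumIso_apply (x : lp (fun _ : β => L2 α) 2) (a : α) (b : β) :
    directSumIso α β x (a, b) = x b a := by
  classical
  have h : directSumIso α β (lp.single 2 b (ket a)) = ket (a, b) := by
    rw [directSumIso, OrthogonalFamily.linearIsometry_apply_single]
    exact embed_ket _ _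
  rw [← ket_inner, ← h, LinearIsometry.inner_map_map, lp.inner_single_left, ket_inner]

lemma adjoint_directSumIso_apply (ψ : L2 (α × β)) (b : β) :
    (directSumIso α β).toContinuousLinearMap.adjoint ψ b = slice b ψ := by
  classical
  ext a
  have h : directSumIso α β (lp.single 2 b (ket a)) = ket (a, b) := by
    rw [directSumIso, OrthogonalFamily.linearIsometry_apply_single]
    exact embed_ket _ _
  rw [← ket_inner, ← lp.inner_single_left (𝕜 := ℂ) (G := fun _ : β => L2 α),
    ContinuousLinearMap.adjoint_inner_right, LinearIsometry.coe_toContinuousLinearMap, h,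
    ket_inner, slice_apply]

/-- `S ⊗ 1` acts on each slice by `S`. With `ext_slice` this characterises `leftOp`. -/
lemma slice_leftOp (T : L2 α →L[ℂ] L2 α) (b : β) (ψ : L2 (α × β)) :
    slice b (leftOp β T ψ) = T (slice b ψ) := by
  ext a
  rw [slice_apply, leftOp]
  simp [directSumIso_apply, adjoint_directSumIso_apply]

lemma leftOp_apply (T : L2 α →L[ℂ] L2 α) (ψ : L2 (α × β)) (a : α) (b : β) :
    leftOp β T ψ (a, b) = T (slice b ψ) a := by
  rw [← slice_apply, slice_leftOp]

lemma adjoint_leftOp (T : L2 α →L[ℂ] L2 α) :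
    (leftOp β T).adjoint = leftOp β T.adjoint := by
  refine ContinuousLinearMap.ext fun ψ => ext_slice fun b => ?_
  rw [slice_leftOp]
  refine ext_inner_left ℂ fun x => ?_
  have h : leftOp β T (tensorKet b x) = tensorKet b (T x) := by
    classical
    refine ext_slice fun b' => ?_
    rw [slice_leftOp]
    by_cases hb : b' = b
    · subst hb
      have : ∀ y : L2 α, slice b' (tensorKet b' y) = y := fun y => by
        refine ext_inner_left ℂ fun z => ?_
        rw [slice, ContinuousLinearMap.adjoint_inner_right]
        exact (tensorKet b').inner_map_map z y
      rw [this, this]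
    · have : ∀ y : L2 α, slice b' (tensorKet b y) = 0 := fun y => by
        refine ext_inner_left ℂ fun z => ?_
        rw [slice, ContinuousLinearMap.adjoint_inner_right, inner_zero_right]
        exact orthogonalFamily_tensorKet α β hb z y
      rw [this, this, map_zero]
  rw [slice, ContinuousLinearMap.adjoint_inner_right, ContinuousLinearMap.adjoint_inner_right,
    ContinuousLinearMap.adjoint_inner_right, ContinuousLinearMap.adjoint_inner_right,
    LinearIsometry.coe_toContinuousLinearMap, h]

/-- Parseval's identity with values in `[0, ∞]`. -/
lemma tsum_ofReal_norm_inner_sq {E : Type*} [NormedAddCommGroup E] [InnerProductSpace ℂ E]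
    (b : HilbertBasis α ℂ E) (x : E) :
    ∑' i, ENNReal.ofReal (‖⟪b i, x⟫_ℂ‖ ^ 2) = ENNReal.ofReal (‖x‖ ^ 2) := by
  have h := (b.hasSum_inner_mul_inner x x).mapL Complex.reCLM
  have h2 : HasSum (fun i => ‖⟪b i, x⟫_ℂ‖ ^ 2) (‖x‖ ^ 2) := by
    convert h using 2 with i
    · rw [← inner_conj_symm x (b i), Complex.reCLM_apply, Complex.conj_mul']
      norm_cast
    · rw [inner_self_eq_norm_sq_to_K]
      simp [← Complex.ofReal_pow]
  rw [← h2.tsum_eq, ENNReal.ofReal_tsum_of_nonneg (fun i => by positivity) h2.summable]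

lemma tsum_ofReal_norm_apply_sq (x : L2 α) :
    ∑' a, ENNReal.ofReal (‖x a‖ ^ 2) = ENNReal.ofReal (‖x‖ ^ 2) := by
  rw [← tsum_ofReal_norm_inner_sq ket x]
  simp_rw [ket_inner]

lemma tsum_ofReal_norm_slice_sq (ψ : L2 (S × R)) :
    ∑' r, ENNReal.ofReal (‖slice r ψ‖ ^ 2) = ENNReal.ofReal (‖ψ‖ ^ 2) := by
  simp_rw [← tsum_ofReal_norm_apply_sq, slice_apply]
  rw [ENNReal.tsum_comm]
  exact (ENNReal.tsum_prod (f := fun s r => ENNReal.ofReal (‖ψ (s, r)‖ ^ 2))).symm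

lemma summable_of_tsum_ofReal_eq {f : α → ℝ} (hf : ∀ a, 0 ≤ f a) {c : ℝ}
    (h : ∑' a, ENNReal.ofReal (f a) = ENNReal.ofReal c) : Summable f := by
  have := ENNReal.summable_toReal (f := fun a => ENNReal.ofReal (f a)) (by simp [h])
  simpa [ENNReal.toReal_ofReal (hf _)] using this

lemma hasSum_norm_slice_sq (ψ : L2 (S × R)) : HasSum (fun r => ‖slice r ψ‖ ^ 2) (‖ψ‖ ^ 2) := by
  have hs := summable_of_tsum_ofReal_eq (fun r => by positivity) (tsum_ofReal_norm_slice_sq ψ)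
  have h := tsum_ofReal_norm_slice_sq ψ
  rw [← ENNReal.ofReal_tsum_of_nonneg (fun r => by positivity) hs,
    ENNReal.ofReal_eq_ofReal_iff (tsum_nonneg fun r => by positivity) (by positivity)] at h
  exact h ▸ hs.hasSum

/-- The tensor product `x ⊗ y` of vectors. -/
noncomputable def tens (x : L2 α) (y : L2 β) : L2 (α × β) :=
  ⟨fun p => x p.1 * y p.2, by
    have hx := (lp.memℓp x).summable (by norm_num)
    have hy := (lp.memℓp y).summable (by norm_num)
    refine memℓp_gen ?_
    refine (hx.mul_of_nonneg hy (fun _ => by positivity) (fun _ => by positivity)).congr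
      fun p => ?_
    rw [norm_mul, Real.mul_rpow (norm_nonneg _) (norm_nonneg _)]⟩

lemma tens_apply (x : L2 α) (y : L2 β) (a : α) (b : β) : tens x y (a, b) = x a * y b := rfl

lemma slice_tens (x : L2 α) (y : L2 β) (b : β) : slice b (tens x y) = y b • x := by
  ext a
  rw [slice_apply, tens_apply]
  simp [mul_comm]

lemma tens_ket_right (x : L2 α) (b : β) : tens x (ket b) = tensorKet b x := by
  refine ext_ket fun p => ?_
  obtain ⟨a, b'⟩ := p
  have h : ⟪(ket (a, b') : L2 (α × β)), tensorKet b x⟫_ℂ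
      = ⟪(tensorKet b' (ket a) : L2 (α × β)), tensorKet b x⟫_ℂ := by
    simp [tensorKet, embed_ket]
    rfl
  rw [ket_inner, tens_apply, h]
  by_cases hb : b' = b
  · subst hb
    rw [LinearIsometry.inner_map_map, ket_inner, ← ket_inner b' (ket b')]
    simp [inner_self_eq_norm_sq_to_K, ket.orthonormal.1]
  · rw [orthogonalFamily_tensorKet α β hb, ← ket_inner b' (ket b), ket.orthonormal.2 hb, mul_zero]

lemma tens_ket_ket (a : α) (b : β) : tens (ket a) (ket b) = ket (a, b) := by
  rw [tens_ket_right, tensorKet, embed_ket]; rfl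

lemma inner_tens_eq_tsum (x : L2 α) (y : L2 β) (ψ : L2 (α × β)) :
    HasSum (fun b => ⟪y b • x, slice b ψ⟫_ℂ) ⟪tens x y, ψ⟫_ℂ := by
  have h := lp.hasSum_inner (𝕜 := ℂ) ((directSumIso α β).toContinuousLinearMap.adjoint (tens x y))
    ((directSumIso α β).toContinuousLinearMap.adjoint ψ)
  have hs : directSumIso α β ((directSumIso α β).toContinuousLinearMap.adjoint ψ) = ψ := by
    ext ⟨a, b⟩
    rw [directSumIso_apply, adjoint_directSumIso_apply, slice_apply]
  rw [ContinuousLinearMap.adjoint_inner_left, LinearIsometry.coe_toContinuousLinearMap, hs] at h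
  simpa only [adjoint_directSumIso_apply, slice_tens] using h

lemma inner_tens (x : L2 α) (y : L2 β) (x' : L2 α) (y' : L2 β) :
    ⟪tens x y, tens x' y'⟫_ℂ = ⟪x, x'⟫_ℂ * ⟪y, y'⟫_ℂ := by
  refine (inner_tens_eq_tsum x y (tens x' y')).unique ?_
  have h := (lp.hasSum_inner (𝕜 := ℂ) y y').mul_left ⟪x, x'⟫_ℂ
  refine h.congr_fun fun b => ?_
  rw [slice_tens, inner_smul_left, inner_smul_right]
  simp only [RCLike.inner_apply]
  ring

lemma norm_tens (x : L2 α) (y : L2 β) : ‖tens x y‖ = ‖x‖ * ‖y‖ := by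
  have h := inner_tens x y x y
  simp only [inner_self_eq_norm_sq_to_K] at h
  have h' : ‖tens x y‖ ^ 2 = (‖x‖ * ‖y‖) ^ 2 := by
    rw [mul_pow]; exact_mod_cast h
  exact (sq_eq_sq₀ (norm_nonneg _) (by positivity)).mp h'

/-- The map `y ↦ x ⊗ y`. -/
noncomputable def tensL (x : L2 α) : L2 β →L[ℂ] L2 (α × β) :=
  LinearMap.mkContinuous
    { toFun := tens x
      map_add' := fun y y' => by ext ⟨a, b⟩; simp [tens_apply, mul_add]
      map_smul' := fun c y => by ext ⟨a, b⟩; simp [tens_apply]; ring } ‖x‖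
    fun y => (norm_tens x y).le

/-- The map `x ↦ x ⊗ y`. -/
noncomputable def tensR (y : L2 β) : L2 α →L[ℂ] L2 (α × β) :=
  LinearMap.mkContinuous
    { toFun := fun x => tens x y
      map_add' := fun x x' => by ext ⟨a, b⟩; simp [tens_apply, add_mul]
      map_smul' := fun c x => by ext ⟨a, b⟩; simp [tens_apply]; ring } ‖y‖
    fun x => by simpa [mul_comm] using (norm_tens x y).le

@[simp] lemma tensL_apply (x : L2 α) (y : L2 β) : tensL x y = tens x y := rfl
@[simp] lemma tensR_apply (y : L2 β) (x : L2 α) : tensR y x = tens x y := rfl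

/-- The contraction `(⟨x| ⊗ 1) ψ`. -/
noncomputable def contrL (x : L2 α) : L2 (α × β) →L[ℂ] L2 β := (tensL x).adjoint

/-- The contraction `(1 ⊗ ⟨y|) ψ`. -/
noncomputable def contrR (y : L2 β) : L2 (α × β) →L[ℂ] L2 α := (tensR y).adjoint

lemma inner_contrL (x : L2 α) (y : L2 β) (ψ : L2 (α × β)) :
    ⟪y, contrL x ψ⟫_ℂ = ⟪tens x y, ψ⟫_ℂ := by
  rw [contrL, ContinuousLinearMap.adjoint_inner_right, tensL_apply]

lemma inner_contrR (x : L2 α) (y : L2 β) (ψ : L2 (α × β)) :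
    ⟪x, contrR y ψ⟫_ℂ = ⟪tens x y, ψ⟫_ℂ := by
  rw [contrR, ContinuousLinearMap.adjoint_inner_right, tensR_apply]

lemma contrL_apply (x : L2 α) (ψ : L2 (α × β)) (b : β) :
    contrL x ψ b = ⟪x, slice b ψ⟫_ℂ := by
  rw [← ket_inner, inner_contrL, tens_ket_right, slice, ContinuousLinearMap.adjoint_inner_right]
  rfl

lemma eq_zero_of_forall_basis {E : Type*} [NormedAddCommGroup E] [InnerProductSpace ℂ E]
    (b : HilbertBasis α ℂ E) {x : E} (h : ∀ i, ⟪b i, x⟫_ℂ = 0) : x = 0 := by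
  refine b.repr.injective ?_
  ext i
  simp [HilbertBasis.repr_apply_apply, h]

/-- The product basis `(a_k ⊗ b_l)` of two orthonormal bases. -/
noncomputable def tensBasis {κ κ' : Type*} (a : HilbertBasis κ ℂ (L2 α))
    (b : HilbertBasis κ' ℂ (L2 β)) : HilbertBasis (κ × κ') ℂ (L2 (α × β)) :=
  HilbertBasis.mkOfOrthogonalEqBot (v := fun p : κ × κ' => tens (a p.1) (b p.2))
    (by
      classical
      rw [orthonormal_iff_ite]
      rintro ⟨i, j⟩ ⟨i', j'⟩
      rw [inner_tens, orthonormal_iff_ite.mp a.orthonormal, orthonormal_iff_ite.mp b.orthonormal]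
      by_cases h : i = i' <;> by_cases h' : j = j' <;> simp [h, h'])
    (by
      rw [Submodule.eq_bot_iff]
      intro v hv
      have h0 : ∀ i j, ⟪tens (a i) (b j), v⟫_ℂ = 0 := fun i j =>
        hv _ (Submodule.subset_span ⟨(i, j), rfl⟩)
      have h1 : ∀ j, contrR (b j) v = 0 := fun j =>
        eq_zero_of_forall_basis a fun i => by rw [inner_contrR, h0]
      have h2 : ∀ x, contrL x v = 0 := fun x =>
        eq_zero_of_forall_basis b fun j => by
          rw [inner_contrL, ← inner_contrR, h1 j, inner_zero_right]
      refine ext_ket fun p => ?_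
      rw [inner_zero_right, ← tens_ket_ket, ← inner_contrL, h2, inner_zero_right])

lemma tensBasis_apply {κ κ' : Type*} (a : HilbertBasis κ ℂ (L2 α))
    (b : HilbertBasis κ' ℂ (L2 β)) (p : κ × κ') : tensBasis a b p = tens (a p.1) (b p.2) := by
  simp [tensBasis]

lemma tensorOp_tens (T : L2 α →L[ℂ] L2 α) (T' : L2 β →L[ℂ] L2 β) (x : L2 α) (y : L2 β) :
    tensorOp T T' (tens x y) = tens (T x) (T' y) := by
  have h1 : reindexOp (Equiv.prodComm β α) (leftOp α T') (tens x y) = tens x (T' y) := by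
    ext ⟨a, b⟩
    rw [reindexOp_apply, embed_equiv_apply]
    have : embed (Equiv.prodComm β α).symm.toEmbedding (tens x y) = tens y x := by
      ext ⟨b, a⟩
      rw [embed_equiv_apply]
      simp [tens_apply, mul_comm]
    rw [this]
    simp [leftOp_apply, slice_tens, tens_apply]
  rw [tensorOp, ContinuousLinearMap.comp_apply, h1]
  ext ⟨a, b⟩
  simp [leftOp_apply, slice_tens, tens_apply, mul_comm]

end Coordinates

/-! ### Marginals of pure states -/

section Marginals

variable {S R U S' R' : Type*}

/-- The marginal on the first factor of the (unnormalised) pure state `|ψ⟩⟨ψ|`. -/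
noncomputable def marg (ψ : L2 (S × R)) : L2 S →L[ℂ] L2 S :=
  trRight (InnerProductSpace.rankOne ℂ ψ ψ)

lemma summable_norm_rankOne_slice (ψ : L2 (S × R)) :
    Summable fun r => ‖InnerProductSpace.rankOne ℂ (slice r ψ) (slice r ψ)‖ := by
  simpa [← sq] using (hasSum_norm_slice_sq ψ).summable

lemma adjoint_comp_rankOne_comp {E F : Type*} [NormedAddCommGroup E] [InnerProductSpace ℂ E]
    [CompleteSpace E] [NormedAddCommGroup F] [InnerProductSpace ℂ F] [CompleteSpace F]
    (A : E →L[ℂ] F) (x : E) :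
    A ∘L InnerProductSpace.rankOne ℂ x x ∘L A.adjoint = InnerProductSpace.rankOne ℂ (A x) (A x) := by
  ext y
  simp [ContinuousLinearMap.adjoint_inner_right]

lemma hasSum_marg (ψ : L2 (S × R)) :
    HasSum (fun r => InnerProductSpace.rankOne ℂ (slice r ψ) (slice r ψ)) (marg ψ) := by
  have h : marg ψ = ∑' r, InnerProductSpace.rankOne ℂ (slice r ψ) (slice r ψ) := by
    rw [marg, trRight]
    refine tsum_congr fun r => ?_
    rw [← adjoint_comp_rankOne_comp, slice, ContinuousLinearMap.adjoint_adjoint]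
  rw [h]
  exact (summable_norm_rankOne_slice ψ).of_norm.hasSum

/-- The matrix elements of a marginal: `⟨x|ρ_S|y⟩ = ⟨(⟨y| ⊗ 1) ψ, (⟨x| ⊗ 1) ψ⟩`. This form does not
refer to a basis of the traced-out factor. -/
lemma inner_marg (ψ : L2 (S × R)) (x y : L2 S) :
    ⟪x, marg ψ y⟫_ℂ = ⟪contrL y ψ, contrL x ψ⟫_ℂ := by
  have h := ((hasSum_marg ψ).mapL (ContinuousLinearMap.apply ℂ (L2 S) y)).mapL (innerSL ℂ x)
  have h2 := lp.hasSum_inner (𝕜 := ℂ) (contrL y ψ) (contrL x ψ)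
  refine h.unique (h2.congr_fun fun r => ?_)
  simp [contrL_apply, mul_comm]

lemma eq_marg_of_inner {T : L2 S →L[ℂ] L2 S} {ψ : L2 (S × R)}
    (h : ∀ x y, ⟪x, T y⟫_ℂ = ⟪contrL y ψ, contrL x ψ⟫_ℂ) : T = marg ψ :=
  ContinuousLinearMap.ext fun y => ext_inner_left ℂ fun x => by rw [h, inner_marg]

/-- Conjugating the first factor of a pure state and relabelling the environment. -/
lemma comp_marg_comp (A : L2 S →L[ℂ] L2 S') (e : R ≃ R') (ψ : L2 (S × R)) (ψ' : L2 (S' × R'))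
    (h : ∀ r, slice (e r) ψ' = A (slice r ψ)) : A ∘L marg ψ ∘L A.adjoint = marg ψ' := by
  refine eq_marg_of_inner fun x y => ?_
  have h1 : ∀ z, contrL z ψ' = embed e.toEmbedding (contrL (A.adjoint z) ψ) := fun z => by
    ext r
    rw [embed_equiv_apply, contrL_apply, contrL_apply, ContinuousLinearMap.adjoint_inner_left, ← h,
      e.apply_symm_apply]
  rw [h1, h1, LinearIsometry.inner_map_map, ← inner_marg, ContinuousLinearMap.adjoint_inner_left]
  rfl

lemma reindexOp_marg (e : S ≃ S') (ψ : L2 (S × R)) :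
    reindexOp e (marg ψ) = marg (embed (e.prodCongr (Equiv.refl R)).toEmbedding ψ) := by
  refine comp_marg_comp _ (Equiv.refl R) _ _ fun r => ?_
  ext s
  rw [LinearIsometry.coe_toContinuousLinearMap, embed_equiv_apply, slice_apply, slice_apply,
    embed_equiv_apply]
  rfl

lemma marg_embed_env (e : R ≃ R') (ψ : L2 (S × R)) :
    marg (embed ((Equiv.refl S).prodCongr e).toEmbedding ψ) = marg ψ := by
  have hid : (ContinuousLinearMap.id ℂ (L2 S)).adjoint = ContinuousLinearMap.id ℂ (L2 S) :=
    star_one (L2 S →L[ℂ] L2 S)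
  rw [← comp_marg_comp (ContinuousLinearMap.id ℂ _) e ψ, hid]
  · rfl
  · intro r
    ext s
    rw [slice_apply, embed_equiv_apply, ContinuousLinearMap.id_apply, slice_apply]
    simp

lemma leftOp_comp_marg_comp (A : L2 S →L[ℂ] L2 S) (hA : A.adjoint = A) (ψ : L2 (S × R)) :
    A ∘L marg ψ ∘L A = marg (leftOp R A ψ) := by
  conv_lhs => rw [← hA]
  nth_rewrite 1 [hA]
  exact comp_marg_comp A (Equiv.refl R) _ _ fun r => slice_leftOp A r ψ

/-- A partial trace of a marginal is the marginal in which the traced-out factor has joined the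
environment. -/
lemma trRight_marg (ψ : L2 ((S × U) × R)) :
    trRight (marg ψ) = marg (embed (Equiv.prodAssoc S U R).toEmbedding ψ) := by
  set ψ' := embed (Equiv.prodAssoc S U R).toEmbedding ψ with hψ'
  have hsl : ∀ u r, slice (u, r) ψ' = slice u (slice r ψ) := fun u r => by
    ext s
    rw [slice_apply, hψ', embed_equiv_apply, slice_apply, slice_apply]
    rfl
  rw [← (hasSum_marg ψ').tsum_eq, (summable_norm_rankOne_slice ψ').of_norm.tsum_prod, trRight]
  refine tsum_congr fun u => ?_
  have h := (hasSum_marg ψ).mapL ((ContinuousLinearMap.compL ℂ (L2 S) (L2 (S × U)) (L2 S)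
    (slice u)).comp ((ContinuousLinearMap.compL ℂ (L2 S) (L2 (S × U)) (L2 (S × U))).flip
      (slice u).adjoint))
  have h2 : (slice u) ∘L marg ψ ∘L (slice u).adjoint
      = ∑' r, InnerProductSpace.rankOne ℂ (slice (u, r) ψ') (slice (u, r) ψ') := by
    refine h.tsum_eq.symm.trans (tsum_congr fun r => ?_)
    rw [hsl, ← adjoint_comp_rankOne_comp (slice u)]
    rfl
  rw [← h2, slice, ContinuousLinearMap.adjoint_adjoint]

lemma trLeft_marg (ψ : L2 ((S × U) × R)) :
    trLeft (marg ψ) = marg (embed (((Equiv.prodComm S U).prodCongr (Equiv.refl R)).trans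
      (Equiv.prodAssoc U S R)).toEmbedding ψ) := by
  rw [trLeft, reindexOp_marg, trRight_marg]
  congr 1
  ext p
  simp only [embed_equiv_apply]
  rfl

lemma trace_marg (ψ : L2 (S × R)) : trace (marg ψ) = ‖ψ‖ ^ 2 := by
  have h : ∀ a, (⟪(ket a : L2 S), marg ψ (ket a)⟫_ℂ).re = ‖contrL (ket a) ψ‖ ^ 2 := fun a => by
    rw [inner_marg, inner_self_eq_norm_sq_to_K]
    simp [← Complex.ofReal_pow]
  have h2 : ∀ a, ‖contrL (ket a) ψ‖
      = ‖slice a (embed (Equiv.prodComm S R).toEmbedding ψ)‖ := fun a => by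
    congr 1
    ext r
    rw [contrL_apply, ket_inner, slice_apply, slice_apply, embed_equiv_apply]
    rfl
  simp_rw [trace, h, h2]
  rw [(hasSum_norm_slice_sq _).tsum_eq, LinearIsometry.norm_map]

lemma marg_smul (c : ℂ) (ψ : L2 (S × R)) : marg (c • ψ) = ((‖c‖ ^ 2 : ℝ) : ℂ) • marg ψ := by
  refine (eq_marg_of_inner fun x y => ?_).symm
  simp only [map_smul, inner_smul_left, inner_smul_right, smul_apply,
    inner_marg]
  rw [← mul_assoc, Complex.mul_conj']
  simp

/-- The trace of a marginal, in any orthonormal basis. -/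
lemma tsum_ofReal_norm_contrL_sq {κ : Type*} (b : HilbertBasis κ ℂ (L2 S)) (ψ : L2 (S × R)) :
    ∑' i, ENNReal.ofReal (‖contrL (b i) ψ‖ ^ 2) = ENNReal.ofReal (‖ψ‖ ^ 2) := by
  simp_rw [← tsum_ofReal_norm_inner_sq ket (contrL (b _) ψ), inner_contrL]
  rw [← tsum_ofReal_norm_inner_sq (tensBasis b ket) ψ, ENNReal.tsum_prod']
  simp_rw [tensBasis_apply]

lemma isPositive_marg (ψ : L2 (S × R)) : (marg ψ).IsPositive := by
  rw [ContinuousLinearMap.isPositive_def]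
  refine ⟨fun x y => ?_, fun x => ?_⟩
  · change ⟪marg ψ x, y⟫_ℂ = ⟪x, marg ψ y⟫_ℂ
    rw [← inner_conj_symm, inner_marg, inner_marg, inner_conj_symm]
  · rw [ContinuousLinearMap.reApplyInnerSelf_apply, ← inner_re_symm, inner_marg]
    exact inner_self_nonneg

lemma isDensityOperator_marg {ψ : L2 (S × R)} (hψ : ‖ψ‖ = 1) : IsDensityOperator (marg ψ) := by
  refine ⟨isPositive_marg ψ, fun w b => ?_⟩
  have h := tsum_ofReal_norm_contrL_sq b ψ
  have hs := summable_of_tsum_ofReal_eq (fun i => by positivity) h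
  rw [← ENNReal.ofReal_tsum_of_nonneg (fun r => by positivity) hs,
    ENNReal.ofReal_eq_ofReal_iff (tsum_nonneg fun r => by positivity) (by positivity)] at h
  have h2 := hs.hasSum
  rw [h, hψ, one_pow] at h2
  have h3 := h2.mapL Complex.ofRealCLM
  refine (h3.congr_fun fun i => ?_).trans_eq ?_
  · rw [inner_marg, inner_self_eq_norm_sq_to_K]; simp
  · simp

lemma isCompactOperator_rankOne {E : Type*} [NormedAddCommGroup E] [InnerProductSpace ℂ E]
    (x y : E) : IsCompactOperator (InnerProductSpace.rankOne ℂ x y) := by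
  have h : IsCompactOperator (id : ℂ → ℂ) := 
    isCompactOperator_id_iff_locallyCompactSpace.mpr inferInstance
  exact (h.clm_comp (ContinuousLinearMap.toSpanSingleton ℂ x)).comp_clm (innerSL ℂ y)

/-- A marginal is a norm-convergent sum of operators of rank one. -/
lemma isCompactOperator_marg (ψ : L2 (S × R)) : IsCompactOperator (marg ψ) := by
  refine isCompactOperator_of_tendsto (hasSum_marg ψ) (Filter.Eventually.of_forall fun s => ?_)
  exact (compactOperator (RingHom.id ℂ) (L2 S) (L2 S)).sum_mem (t := s)
    fun r _ => isCompactOperator_rankOne _ _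

end Marginals

/-! ### Eigenbases and the relative entropy -/

section Spectral

variable {α κ κ' ι ι' S R : Type*}

/-- An orthonormal eigenbasis with real eigenvalues, labelled by an arbitrary type. -/
structure EigenBasis (ι : Type*) {α : Type*} (T : L2 α →L[ℂ] L2 α) where
  /-- the orthonormal eigenbasis -/
  vec : HilbertBasis ι ℂ (L2 α)
  /-- the eigenvalues -/
  val : ι → ℝ
  apply_vec : ∀ i, T (vec i) = (val i : ℂ) • vec i

/-- A spectral decomposition as an eigenbasis. -/
def SpectralDecomposition.toEigenBasis {T : L2 α →L[ℂ] L2 α} (d : SpectralDecomposition T) :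
    EigenBasis α T := ⟨d.vec, d.val, d.apply_vec⟩

lemma EigenBasis.inner_apply {T : L2 α →L[ℂ] L2 α} (d : EigenBasis ι T) (i : ι) (x : L2 α) :
    ⟪d.vec i, T x⟫_ℂ = d.val i * ⟪d.vec i, x⟫_ℂ := by
  classical
  have h : (innerSL ℂ (d.vec i)) ∘L T = (d.val i : ℂ) • innerSL ℂ (d.vec i) := by
    refine ContinuousLinearMap.ext_on (s := Set.range d.vec)
      (Submodule.dense_iff_topologicalClosure_eq_top.mpr d.vec.dense_span) ?_
    rintro _ ⟨j, rfl⟩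
    by_cases hij : i = j
    · subst hij
      simp [d.apply_vec]
    · simp [d.apply_vec, d.vec.orthonormal.2 hij]
  exact congrArg (fun M : L2 α →L[ℂ] ℂ => M x) h

/-- The eigenspace of `T` at the real number `q`. -/
noncomputable def realEigenspace (T : L2 α →L[ℂ] L2 α) (q : ℝ) : Submodule ℂ (L2 α) :=
  (T - (q : ℂ) • ContinuousLinearMap.id ℂ (L2 α)).ker

lemma mem_realEigenspace {T : L2 α →L[ℂ] L2 α} {q : ℝ} {x : L2 α} :
    x ∈ realEigenspace T q ↔ T x = (q : ℂ) • x := by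
  rw [realEigenspace, LinearMap.mem_ker, ContinuousLinearMap.coe_coe, sub_apply, sub_eq_zero]
  rfl

instance (T : L2 α →L[ℂ] L2 α) (q : ℝ) : (realEigenspace T q).HasOrthogonalProjection := by
  have : IsClosed (realEigenspace T q : Set (L2 α)) := ContinuousLinearMap.isClosed_ker _
  have : CompleteSpace (realEigenspace T q) := this.completeSpace_coe
  infer_instance

/-- The weight of the eigenvalues in a vector `x` is expressed by the norms of the projections of
`x` on the eigenspaces, which do not depend on the eigenbasis. -/
lemma EigenBasis.tsum_weight {T : L2 α →L[ℂ] L2 α} (d : EigenBasis ι T) (x : L2 α)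
    (g : ℝ → ℝ≥0∞) :
    ∑' j, ENNReal.ofReal (‖⟪d.vec j, x⟫_ℂ‖ ^ 2) * g (d.val j)
      = ∑' q : ℝ, ENNReal.ofReal (‖(realEigenspace T q).starProjection x‖ ^ 2) * g q := by
  classical
  have key : ∀ q j, ⟪d.vec j, (realEigenspace T q).starProjection x⟫_ℂ
      = if q = d.val j then ⟪d.vec j, x⟫_ℂ else 0 := by
    intro q j
    split_ifs with h
    · have h1 : d.vec j ∈ realEigenspace T q := mem_realEigenspace.mpr (h ▸ d.apply_vec j)
      have h2 := (realEigenspace T q).sub_starProjection_mem_orthogonal x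
      have h3 := h2 _ h1
      rw [inner_sub_right, sub_eq_zero] at h3
      exact h3.symm
    · have h1 := mem_realEigenspace.mp ((realEigenspace T q).starProjection_apply_mem x)
      have h2 := d.inner_apply j ((realEigenspace T q).starProjection x)
      rw [h1, inner_smul_right] at h2
      have h3 : ((q : ℂ) - d.val j) ≠ 0 := by
        rw [sub_ne_zero]
        exact_mod_cast h
      have h4 : ((q : ℂ) - d.val j) * ⟪d.vec j, (realEigenspace T q).starProjection x⟫_ℂ = 0 := by
        rw [sub_mul, h2, sub_self]
      exact (mul_eq_zero.mp h4).resolve_left h3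
  simp_rw [← tsum_ofReal_norm_inner_sq d.vec ((realEigenspace T _).starProjection x), key,
    ← ENNReal.tsum_mul_right]
  rw [ENNReal.tsum_comm]
  refine tsum_congr fun j => ?_
  rw [tsum_eq_single (d.val j)]
  · simp
  · intro q hq
    simp [hq]

/-- The double sum defining the relative entropy, for two eigenbases. -/
noncomputable def relSum {ρ σ : L2 α →L[ℂ] L2 α} (d : EigenBasis ι ρ) (d' : EigenBasis ι' σ) :
    ℝ≥0∞ :=
  ∑' (i : ι) (j : ι'),
    ENNReal.ofReal (‖⟪d.vec i, d'.vec j⟫_ℂ‖ ^ 2) * relEntropyTerm (d.val i) (d'.val j)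

/-- The double sum does not depend on the eigenbases: they are exchanged one after the other, each
by `EigenBasis.tsum_weight`. -/
lemma relSum_congr {ρ σ : L2 α →L[ℂ] L2 α} {η η' : Type*} (d : EigenBasis ι ρ)
    (d' : EigenBasis ι' σ) (e : EigenBasis η ρ) (e' : EigenBasis η' σ) :
    relSum d d' = relSum e e' := by
  have h1 : relSum d d' = relSum d e' := by
    refine tsum_congr fun i => ?_
    simp_rw [norm_inner_symm (d.vec i)]
    rw [d'.tsum_weight (d.vec i) (relEntropyTerm (d.val i)), ← e'.tsum_weight]
  rw [h1, relSum, relSum, ENNReal.tsum_comm, ENNReal.tsum_comm (f := fun (i : η) (j : η') => _)]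
  refine tsum_congr fun j => ?_
  rw [d.tsum_weight (e'.vec j) (fun p => relEntropyTerm p (e'.val j)), ← e.tsum_weight]

/-- The relative entropy can be computed in eigenbases with arbitrary labels. The spectral
decompositions are needed only for the infimum defining `relEntropy` to be over a nonempty set. -/
lemma relEntropy_eq_relSum {ρ σ : L2 α →L[ℂ] L2 α} (hρ : Nonempty (SpectralDecomposition ρ))
    (hσ : Nonempty (SpectralDecomposition σ)) (d : EigenBasis ι ρ) (d' : EigenBasis ι' σ) :
    relEntropy ρ σ = relSum d d' := by
  have h : ∀ (e : SpectralDecomposition ρ) (e' : SpectralDecomposition σ),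
      ∑' (i : α) (j : α), ENNReal.ofReal (‖⟪e.vec i, e'.vec j⟫_ℂ‖ ^ 2) *
        relEntropyTerm (e.val i) (e'.val j) = relSum d d' := fun e e' =>
    relSum_congr e.toEigenBasis e'.toEigenBasis d d'
  simp_rw [relEntropy, h, ciInf_const]

/-! ### Existence of spectral decompositions -/

lemma finite_of_hilbertBasis {E : Type*} [NormedAddCommGroup E] [InnerProductSpace ℂ E]
    (b : HilbertBasis κ ℂ E) (b' : HilbertBasis κ' ℂ E) [Finite κ] : Finite κ' := by
  have := Fintype.ofFinite κ
  have : FiniteDimensional ℂ E := b.toOrthonormalBasis.toBasis.finiteDimensional_of_finite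
  exact b'.orthonormal.linearIndependent.finite

/-- An orthonormal basis is countable if some countable family is total: every vector of the family
has countably many nonzero coordinates. -/
lemma countable_of_hilbertBasis [Countable α] {E : Type*} [NormedAddCommGroup E]
    [InnerProductSpace ℂ E] (b : HilbertBasis κ ℂ E) (u : α → E)
    (hu : ∀ x, (∀ a, ⟪u a, x⟫_ℂ = 0) → x = 0) : Countable κ := by
  have h1 : ∀ a : α, {i | ⟪b i, u a⟫_ℂ ≠ 0}.Countable := fun a => by
    have hs := summable_of_tsum_ofReal_eq (fun i => by positivity)
      (tsum_ofReal_norm_inner_sq b (u a))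
    refine hs.countable_support.mono fun i hi => ?_
    simpa using hi
  have h2 : (⋃ a : α, {i | ⟪b i, u a⟫_ℂ ≠ 0}) = Set.univ := by
    refine Set.eq_univ_of_forall fun i => ?_
    by_contra hi
    simp only [Set.mem_iUnion, not_exists] at hi
    have h0 : b i = 0 := hu _ fun a => by
      rw [← inner_conj_symm, map_eq_zero]
      simpa using hi a
    have := b.orthonormal.1 i
    rw [h0] at this
    simp at this
  exact Set.countable_univ_iff.mp (h2 ▸ Set.countable_iUnion h1)

lemma countable_basisIndex (E : Type*) [NormedAddCommGroup E] [InnerProductSpace ℂ E]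
    [CompleteSpace E] [TopologicalSpace.SeparableSpace E] : Countable (BasisIndex E) := by
  refine countable_of_hilbertBasis (fixedBasis E) (TopologicalSpace.denseSeq E) fun x hx => ?_
  have h : (fun y => ⟪y, x⟫_ℂ) = fun _ => 0 :=
    (TopologicalSpace.denseRange_denseSeq E).equalizer (by fun_prop) (by fun_prop) (funext hx)
  exact inner_self_eq_zero.mp (congrFun h x)

/-- All orthonormal bases of `ℓ²(α)`, `α` countable, can be labelled by `α`. -/
lemma nonempty_equiv_of_hilbertBasis [Countable α] (b : HilbertBasis κ ℂ (L2 α)) :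
    Nonempty (κ ≃ α) := by
  have := countable_of_hilbertBasis b ket fun x hx => eq_zero_of_forall_basis ket hx
  cases finite_or_infinite κ with
  | inl hκ =>
    have hα : Finite α := finite_of_hilbertBasis b ket
    have := Fintype.ofFinite κ
    have := Fintype.ofFinite α
    refine Fintype.card_eq.mp ?_
    rw [← Module.finrank_eq_card_basis b.toOrthonormalBasis.toBasis,
      ← Module.finrank_eq_card_basis (ket (ι := α)).toOrthonormalBasis.toBasis]
  | inr hκ =>
    have hα : Infinite α := by
      by_contra h
      rw [not_infinite_iff_finite] at h
      have := finite_of_hilbertBasis ket b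
      exact not_finite κ
    exact nonempty_equiv_of_countable

lemma EigenBasis.nonempty_spectralDecomposition [Countable α] {T : L2 α →L[ℂ] L2 α}
    (d : EigenBasis ι T) : Nonempty (SpectralDecomposition T) := by
  obtain ⟨e⟩ := nonempty_equiv_of_hilbertBasis d.vec
  refine ⟨⟨HilbertBasis.mk (v := d.vec ∘ e.symm) (d.vec.orthonormal.comp _ e.symm.injective) ?_,
    d.val ∘ e.symm, fun i => ?_⟩⟩
  · rw [e.symm.surjective.range_comp, d.vec.dense_span]
  · simp [d.apply_vec]

/-- The spectral theorem for compact self-adjoint operators, in terms of an eigenbasis. -/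
lemma exists_hilbertBasis_eigenvectors {E : Type*} [NormedAddCommGroup E] [InnerProductSpace ℂ E]
    [CompleteSpace E] {T : E →L[ℂ] E} (hT : IsCompactOperator T) (hT' : T.IsSymmetric) :
    ∃ (w : ∀ μ, Set (Module.End.eigenspace (T : Module.End ℂ E) μ))
      (b : HilbertBasis (Σ μ, w μ) ℂ E), ∀ i, T (b i) = (i.1.re : ℂ) • b i := by
  let V : ℂ → Submodule ℂ E := fun μ => Module.End.eigenspace (T : Module.End ℂ E) μ
  have hc : ∀ μ : ℂ, CompleteSpace (V μ) := fun μ =>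
    (ContinuousLinearMap.isClosed_eigenspace T μ).completeSpace_coe
  choose w b hb using fun μ : ℂ => exists_hilbertBasis ℂ (V μ)
  have ho : Orthonormal ℂ (fun a : Σ μ : ℂ, w μ => ((b a.1 a.2 : V a.1) : E)) :=
    hT'.orthogonalFamily_eigenspaces.orthonormal_sigma_orthonormal fun μ => (b μ).orthonormal
  have hbot : (Submodule.span ℂ (Set.range
      (fun a : Σ μ : ℂ, w μ => ((b a.1 a.2 : V a.1) : E))))ᗮ = ⊥ := by
    rw [Submodule.eq_bot_iff]
    intro v hv
    have h1 : v ∈ (⨆ μ, V μ)ᗮ := by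
      rw [← Submodule.iInf_orthogonal, Submodule.mem_iInf]
      intro μ x hx
      have h0 : (V μ).orthogonalProjectionOnto v = 0 := by
        refine eq_zero_of_forall_basis (b μ) fun i => ?_
        rw [Submodule.inner_orthogonalProjectionOnto_eq_of_mem_left]
        exact hv _ (Submodule.subset_span ⟨⟨μ, i⟩, rfl⟩)
      have h2 := Submodule.inner_orthogonalProjectionOnto_eq_of_mem_left (⟨x, hx⟩ : V μ) v
      rw [h0, inner_zero_right] at h2
      exact h2.symm
    rwa [ContinuousLinearMap.orthogonalComplement_iSup_eigenspaces_eq_bot hT hT',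
      Submodule.mem_bot] at h1
  refine ⟨w, HilbertBasis.mkOfOrthogonalEqBot ho hbot, fun a => ?_⟩
  rw [HilbertBasis.coe_mkOfOrthogonalEqBot]
  have hev : Module.End.HasEigenvalue (T : Module.End ℂ E) a.1 :=
    Module.End.hasEigenvalue_of_hasEigenvector ⟨(b a.1 a.2).2, ho.ne_zero a⟩
  rw [Complex.conj_eq_iff_re.mp (hT'.conj_eigenvalue_eq_self hev)]
  exact Module.End.mem_eigenspace_iff.mp (b a.1 a.2).2

lemma nonempty_spectralDecomposition_marg [Countable S] (ψ : L2 (S × R)) :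
    Nonempty (SpectralDecomposition (marg ψ)) := by
  obtain ⟨w, b, hb⟩ := exists_hilbertBasis_eigenvectors (isCompactOperator_marg ψ)
    (isPositive_marg ψ).1
  exact EigenBasis.nonempty_spectralDecomposition ⟨b, fun i => i.1.re, hb⟩

end Spectral

/-! ### Schmidt decomposition -/

section Schmidt

variable {α γ δ κ ι ιA ιC ιD S R : Type*}

/-- The product eigenbasis of `T ⊗ T'`. -/
noncomputable def EigenBasis.tensor {T : L2 α →L[ℂ] L2 α} {T' : L2 γ →L[ℂ] L2 γ}
    (d : EigenBasis ι T) (d' : EigenBasis κ T') : EigenBasis (ι × κ) (tensorOp T T') where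
  vec := tensBasis d.vec d'.vec
  val p := d.val p.1 * d'.val p.2
  apply_vec p := by
    rw [tensBasis_apply, tensorOp_tens, d.apply_vec, d'.apply_vec, ← tensL_apply, map_smul, tensL_apply,
      ← tensR_apply, map_smul, tensR_apply, smul_smul, mul_comm, Complex.ofReal_mul]

lemma contrL_embed_prodComm (y : L2 R) (ψ : L2 (S × R)) :
    contrL y (embed (Equiv.prodComm S R).toEmbedding ψ) = contrR y ψ := by
  refine ext_inner_left ℂ fun x => ?_
  rw [inner_contrL, inner_contrR, ← (embed (Equiv.prodComm S R).toEmbedding).inner_map_map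
    (tens x y)]
  congr 1
  ext ⟨r, s⟩
  rw [embed_equiv_apply, tens_apply, mul_comm]
  rfl

lemma EigenBasis.val_eq_norm_sq {ψ : L2 (S × R)} (d : EigenBasis ι (marg ψ)) (i : ι) :
    d.val i = ‖contrL (d.vec i) ψ‖ ^ 2 := by
  have h := inner_marg ψ (d.vec i) (d.vec i)
  rw [d.apply_vec, inner_smul_right, inner_self_eq_norm_sq_to_K, inner_self_eq_norm_sq_to_K,
    d.vec.orthonormal.1] at h
  simp only [RCLike.ofReal_one, one_pow, mul_one] at h
  exact Complex.ofReal_injective (by simpa using h)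

lemma EigenBasis.val_nonneg {ψ : L2 (S × R)} (d : EigenBasis ι (marg ψ)) (i : ι) :
    0 ≤ d.val i := by
  rw [d.val_eq_norm_sq]
  positivity

lemma EigenBasis.tsum_val {ψ : L2 (S × R)} (d : EigenBasis ι (marg ψ)) :
    ∑' i, ENNReal.ofReal (d.val i) = ENNReal.ofReal (‖ψ‖ ^ 2) := by
  simp_rw [d.val_eq_norm_sq]
  exact tsum_ofReal_norm_contrL_sq d.vec ψ

/-- The Schmidt decomposition: an eigenbasis `(δ_i)` of one marginal of a pure state yields an
eigenbasis of the other marginal, made of the normalised contractions `(1 ⊗ ⟨δ_i|) ψ` and of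
vectors in the kernel. -/
lemma exists_schmidt (ψ : L2 (S × R))
    (d : EigenBasis ι (marg (embed (Equiv.prodComm S R).toEmbedding ψ))) :
    ∃ (w : Set (L2 S)) (e : EigenBasis w (marg ψ)) (f : {i // d.val i ≠ 0} → w),
      Function.Injective f ∧ (∀ i, e.val (f i) = d.val i) ∧
      (∀ i : {i // d.val i ≠ 0}, e.vec (f i) = ((√(d.val i))⁻¹ : ℂ) • contrR (d.vec i) ψ) ∧
      ∀ j ∉ Set.range f, e.val j = 0 := by
  classical
  -- the contractions `ξ i` are orthogonal, of squared norm the `i`-th eigenvalue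
  set ξ : ι → L2 S := fun i => contrR (d.vec i) ψ with hξ
  have hval : ∀ i, d.val i = ‖ξ i‖ ^ 2 := fun i => by
    rw [d.val_eq_norm_sq, contrL_embed_prodComm]
  have hξξ : ∀ i j, ⟪ξ i, ξ j⟫_ℂ = if i = j then (d.val i : ℂ) else 0 := fun i j => by
    have h := inner_marg (embed (Equiv.prodComm S R).toEmbedding ψ) (d.vec j) (d.vec i)
    rw [contrL_embed_prodComm, contrL_embed_prodComm, d.apply_vec, inner_smul_right,
      orthonormal_iff_ite.mp d.vec.orthonormal] at h
    rw [← h]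
    by_cases hij : i = j
    · simp [hij]
    · simp [hij, Ne.symm hij]
  have hsq : ∀ i : {i // d.val i ≠ 0}, ((√(d.val i) : ℝ) : ℂ) * (√(d.val i) : ℝ) = d.val i :=
    fun i => by
      have h0 : 0 ≤ d.val i := by rw [hval]; positivity
      rw [← Complex.ofReal_mul, Real.mul_self_sqrt h0]
  have hne : ∀ i : {i // d.val i ≠ 0}, ((√(d.val i) : ℝ) : ℂ) ≠ 0 := fun i h => by
    have := hsq i
    rw [h, mul_zero] at this
    exact i.2 (by exact_mod_cast this.symm)
  set v : {i // d.val i ≠ 0} → L2 S := fun i => ((√(d.val i))⁻¹ : ℂ) • ξ i with hv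
  have hvo : Orthonormal ℂ v := by
    rw [orthonormal_iff_ite]
    intro i j
    simp only [hv, inner_smul_left, inner_smul_right, hξξ, Subtype.ext_iff]
    split_ifs with hij
    · have hij' : i = j := Subtype.ext hij
      subst hij'
      rw [← hsq i]
      simp only [map_inv₀, Complex.conj_ofReal]
      field_simp [hne i]
    · simp
  obtain ⟨w, b, hw, hb⟩ := hvo.toSubtypeRange.exists_hilbertBasis_extension
  let f : {i // d.val i ≠ 0} → w := fun i => ⟨v i, hw ⟨i, rfl⟩⟩
  have hbf : ∀ i, b (f i) = v i := fun i => by rw [hb]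
  have hf : Function.Injective f := fun i j hij =>
    hvo.linearIndependent.injective (Subtype.ext_iff.mp hij)
  have hcξ : ∀ i, contrL (ξ i) ψ = (d.val i : ℂ) • d.vec i := fun i => by
    rw [← sub_eq_zero]
    refine eq_zero_of_forall_basis d.vec fun j => ?_
    rw [inner_sub_right, inner_contrL, ← inner_contrR, hξξ, inner_smul_right,
      orthonormal_iff_ite.mp d.vec.orthonormal]
    by_cases hij : i = j
    · simp [hij]
    · simp [hij, Ne.symm hij]
  have hTξ : ∀ i, marg ψ (ξ i) = (d.val i : ℂ) • ξ i := fun i =>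
    ext_inner_left ℂ fun x => by
      rw [inner_marg, hcξ, inner_smul_left, inner_smul_right, inner_contrL, ← inner_contrR]
      simp [hξ]
  let val : w → ℝ := fun j => if h : ∃ i, f i = j then d.val h.choose else 0
  have hvalf : ∀ i, val (f i) = d.val i := fun i => by
    have h : ∃ i', f i' = f i := ⟨i, rfl⟩
    simp only [val, dif_pos h]
    rw [hf h.choose_spec]
  have hval0 : ∀ j ∉ Set.range f, val j = 0 := fun j hj => by
    simp only [val]
    rw [dif_neg]
    simpa using hj
  refine ⟨w, ⟨b, val, fun j => ?_⟩, f, hf, hvalf, hbf, hval0⟩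
  -- a basis vector off the range of `f` is orthogonal to all `ξ i`, hence in the kernel
  by_cases hj : j ∈ Set.range f
  · obtain ⟨i, rfl⟩ := hj
    rw [hvalf, hbf]
    simp only [hv]
    rw [map_smul, hTξ, smul_comm]
  · rw [hval0 j hj]
    have h0 : ∀ i, ⟪ξ i, b j⟫_ℂ = 0 := fun i => by
      by_cases hi : d.val i = 0
      · have : ξ i = 0 :=
          norm_eq_zero.mp (pow_eq_zero_iff two_ne_zero |>.mp ((hval i).symm.trans hi))
        rw [this, inner_zero_left]
      · have h1 : ⟪b (f ⟨i, hi⟩), b j⟫_ℂ = 0 := b.orthonormal.2 fun h => hj ⟨_, h⟩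
        rw [hbf] at h1
        simp only [hv, inner_smul_left] at h1
        refine (mul_eq_zero.mp h1).resolve_left ?_
        simpa using hne ⟨i, hi⟩
    have h1 : contrL (b j) ψ = 0 := eq_zero_of_forall_basis d.vec fun i => by
      rw [inner_contrL, ← inner_contrR, ← inner_conj_symm, h0, map_zero]
    refine ext_inner_left ℂ fun x => ?_
    rw [inner_marg, h1]
    simp

/-- The factor converting nats to bits. -/
noncomputable def bitFactor : ℝ≥0∞ := ENNReal.ofReal (1 / Real.log 2)

lemma relEntropyTerm_zero_left (q : ℝ) :
    relEntropyTerm 0 q = bitFactor * ENNReal.ofReal q := by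
  have : 0 < Real.log 2 := Real.log_pos (by norm_num)
  rw [relEntropyTerm, bitFactor, ← ENNReal.ofReal_mul (by positivity)]
  by_cases h : q = 0
  · simp [h]
  · rw [if_neg h]
    congr 1
    rw [zero_mul, zero_add, sub_zero]
    ring

/-- The relative entropy of `ρ_AC` and `ρ_A ⊗ ρ_C` for a pure state `ψ` on `A C D`, in terms of the
eigenbases of the three one-party marginals. The kernel of `ρ_AC` contributes only through the
mass `r` that `ρ_A ⊗ ρ_C` has there. -/
lemma exists_relEntropy_eq [Countable α] [Countable γ] (ψ : L2 ((α × γ) × δ))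
    {TA : L2 α →L[ℂ] L2 α} {TC : L2 γ →L[ℂ] L2 γ} (dA : EigenBasis ιA TA) (dC : EigenBasis ιC TC)
    (hA : ∀ k, 0 ≤ dA.val k)
    (hA1 : ∑' k, ENNReal.ofReal (dA.val k) = 1) (hC1 : ∑' l, ENNReal.ofReal (dC.val l) = 1)
    (dD : EigenBasis ιD (marg (embed (Equiv.prodComm (α × γ) δ).toEmbedding ψ)))
    (t : ιA → ιC → ιD → ℝ)
    (ht : ∀ k l i, t k l i = ‖⟪tens (tens (dA.vec k) (dC.vec l)) (dD.vec i), ψ⟫_ℂ‖ ^ 2) :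
    ∃ r : ℝ≥0∞,
      r + ∑' (k) (l) (i), ENNReal.ofReal (t k l i / dD.val i) *
        ENNReal.ofReal (dA.val k * dC.val l) = 1 ∧
      relEntropy (marg ψ) (tensorOp TA TC) = bitFactor * r +
        ∑' (k) (l) (i), ENNReal.ofReal (t k l i / dD.val i) *
          relEntropyTerm (dD.val i) (dA.val k * dC.val l) := by
  classical
  obtain ⟨w, e, f, hf, hef, hvf, he0⟩ := exists_schmidt ψ dD
  -- splits a sum over the eigenbasis of `ρ_AC` into its parts on and off the kernel
  have split : ∀ g : ℝ → ℝ → ℝ≥0∞,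
      ∑' j, ∑' p : ιA × ιC, ENNReal.ofReal (‖⟪e.vec j, (dA.tensor dC).vec p⟫_ℂ‖ ^ 2) *
          g (e.val j) ((dA.tensor dC).val p)
        = (∑' j : ((Set.range f)ᶜ : Set w), ∑' p : ιA × ιC,
            ENNReal.ofReal (‖⟪e.vec j, (dA.tensor dC).vec p⟫_ℂ‖ ^ 2) *
              g 0 ((dA.tensor dC).val p)) +
          ∑' (k) (l) (i), ENNReal.ofReal (t k l i / dD.val i) *
            g (dD.val i) (dA.val k * dC.val l) := by
    intro g
    rw [← ENNReal.summable.tsum_add_tsum_compl (s := Set.range f) ENNReal.summable, add_comm]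
    congr 1
    · refine tsum_congr fun j => ?_
      rw [he0 j j.2]
    · rw [tsum_range (g := f) (f := fun j => ∑' p : ιA × ιC,
        ENNReal.ofReal (‖⟪e.vec j, (dA.tensor dC).vec p⟫_ℂ‖ ^ 2) *
          g (e.val j) ((dA.tensor dC).val p)) hf]
      have h1 : ∀ i : {i // dD.val i ≠ 0}, ∀ p : ιA × ιC,
          ‖⟪e.vec (f i), (dA.tensor dC).vec p⟫_ℂ‖ ^ 2 = t p.1 p.2 i / dD.val i := by
        rintro i ⟨k, l⟩
        have h0 : 0 ≤ dD.val i := dD.val_nonneg i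
        rw [hvf, ht, inner_smul_left, norm_mul, mul_pow, norm_inner_symm, ← inner_contrR,
          EigenBasis.tensor, tensBasis_apply, mul_comm, div_eq_mul_inv]
        congr 1
        simp [abs_of_nonneg (Real.sqrt_nonneg _), Real.sq_sqrt h0]
      simp_rw [h1, hef]
      refine (tsum_subtype_eq_of_support_subset (s := {i | dD.val i ≠ 0}) (f := fun i =>
        ∑' p : ιA × ιC, ENNReal.ofReal (t p.1 p.2 i / dD.val i) *
          g (dD.val i) ((dA.tensor dC).val p)) ?_).trans ?_
      · intro i hi h0
        refine hi ?_
        have h0' : dD.val i = 0 := h0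
        simp [h0']
      · rw [ENNReal.tsum_comm, ENNReal.tsum_prod']
        rfl
  refine ⟨∑' j : ((Set.range f)ᶜ : Set w), ∑' p : ιA × ιC,
    ENNReal.ofReal (‖⟪e.vec j, (dA.tensor dC).vec p⟫_ℂ‖ ^ 2) *
      ENNReal.ofReal ((dA.tensor dC).val p), ?_, ?_⟩
  · rw [← split fun _ q => ENNReal.ofReal q, ENNReal.tsum_comm]
    simp_rw [ENNReal.tsum_mul_right, tsum_ofReal_norm_inner_sq, (dA.tensor dC).vec.orthonormal.1]
    have : ∀ p : ιA × ιC, ENNReal.ofReal ((dA.tensor dC).val p)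
        = ENNReal.ofReal (dA.val p.1) * ENNReal.ofReal (dC.val p.2) := fun p =>
      ENNReal.ofReal_mul (hA _)
    simp_rw [this, ENNReal.tsum_prod', ENNReal.tsum_mul_left, hC1]
    simpa using hA1
  · rw [relEntropy_eq_relSum (nonempty_spectralDecomposition_marg ψ)
      (dA.tensor dC).nonempty_spectralDecomposition e (dA.tensor dC), relSum, split relEntropyTerm]
    congr 1
    rw [← ENNReal.tsum_mul_left]
    refine tsum_congr fun j => ?_
    rw [← ENNReal.tsum_mul_left]
    refine tsum_congr fun p => ?_
    rw [relEntropyTerm_zero_left]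
    ring

end Schmidt

/-! ### The sum rule for mutual informations in a pure state -/

section SumRule

variable {α γ δ : Type*}

/-- The exchange `(A C) D ≃ (A D) C`. -/
def swapLast (α γ δ : Type*) : (α × γ) × δ ≃ (α × δ) × γ where
  toFun x := ((x.1.1, x.2), x.1.2)
  invFun x := ((x.1.1, x.2), x.1.2)
  left_inv _ := rfl
  right_inv _ := rfl

lemma relEntropyTerm_of_pos {p q : ℝ} (hp : 0 < p) (hq : 0 < q) :
    relEntropyTerm p q = ENNReal.ofReal ((p * Real.log (p / q) + q - p) / Real.log 2) ∧
      0 ≤ (p * Real.log (p / q) + q - p) / Real.log 2 := by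
  refine ⟨if_neg hq.ne', div_nonneg ?_ (Real.log_nonneg (by norm_num))⟩
  have h := Real.log_le_sub_one_of_pos (div_pos hq hp)
  rw [← neg_neg (Real.log (q / p)), ← Real.log_inv, inv_div] at h
  have h2 := mul_le_mul_of_nonneg_left h hp.le
  have h3 : p * (q / p - 1) = q - p := by field_simp
  linarith

/-- The logarithms of the eigenvalues of `ρ_C` and `ρ_D` cancel in the sum of the terms of
`D(ρ_AC‖ρ_A ⊗ ρ_C)` and `D(ρ_AD‖ρ_A ⊗ ρ_D)`. -/
lemma relEntropyTerm_add_relEntropyTerm {t a c p : ℝ} (ht : 0 ≤ t) (ha : 0 ≤ a) (ha1 : a ≤ 1)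
    (hc : 0 ≤ c) (hp : 0 ≤ p) (hta : a = 0 → t = 0) (htc : c = 0 → t = 0) (htp : p = 0 → t = 0) :
    ENNReal.ofReal (t / p) * relEntropyTerm p (a * c) +
        ENNReal.ofReal (t / c) * relEntropyTerm c (a * p) + 2 * (bitFactor * ENNReal.ofReal t)
      = 2 * (bitFactor * (ENNReal.ofReal t * ENNReal.ofReal (-Real.log a))) +
        bitFactor * (ENNReal.ofReal (t / p) * ENNReal.ofReal (a * c)) +
        bitFactor * (ENNReal.ofReal (t / c) * ENNReal.ofReal (a * p)) := by
  rcases ht.eq_or_lt with rfl | ht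
  · simp
  have ha' : 0 < a := ha.lt_of_ne fun h => ht.ne' (hta h.symm)
  have hc' : 0 < c := hc.lt_of_ne fun h => ht.ne' (htc h.symm)
  have hp' : 0 < p := hp.lt_of_ne fun h => ht.ne' (htp h.symm)
  obtain ⟨h1, h1'⟩ := relEntropyTerm_of_pos hp' (mul_pos ha' hc')
  obtain ⟨h2, h2'⟩ := relEntropyTerm_of_pos hc' (mul_pos ha' hp')
  have hL : 0 < Real.log 2 := Real.log_pos (by norm_num)
  have hla : 0 ≤ -Real.log a := by
    rw [neg_nonneg]
    exact Real.log_nonpos ha ha1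
  have e2 : (2 : ℝ≥0∞) = ENNReal.ofReal 2 := by simp
  rw [h1, h2, bitFactor, e2]
  have n1 := mul_nonneg (div_nonneg ht.le hp) h1'
  have n2 := mul_nonneg (div_nonneg ht.le hc) h2'
  simp only [← ENNReal.ofReal_mul (div_nonneg ht.le hp), ← ENNReal.ofReal_mul (div_nonneg ht.le hc),
    ← ENNReal.ofReal_mul ht.le, ← ENNReal.ofReal_mul (one_div_nonneg.mpr hL.le),
    ← ENNReal.ofReal_mul (zero_le_two (α := ℝ))]
  rw [← ENNReal.ofReal_add n1 n2, ← ENNReal.ofReal_add (add_nonneg n1 n2) (by positivity),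
    ← ENNReal.ofReal_add (by positivity) (by positivity),
    ← ENNReal.ofReal_add (by positivity) (by positivity)]
  congr 1
  rw [Real.log_div hp'.ne' (by positivity), Real.log_div hc'.ne' (by positivity),
    Real.log_mul ha'.ne' hc'.ne', Real.log_mul ha'.ne' hp'.ne']
  field_simp
  ring

/-- The von Neumann entropy (in bits) of a density operator. As for `relEntropy`, the infimum is
over a single value. -/
noncomputable def vonNeumannEntropy (T : L2 α →L[ℂ] L2 α) : ℝ≥0∞ :=
  ⨅ d : SpectralDecomposition T, ∑' k, ENNReal.ofReal (Real.negMulLog (d.val k) / Real.log 2)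

lemma embed_prodAssoc_tens (x : L2 α) (y : L2 γ) (z : L2 δ) :
    embed (Equiv.prodAssoc α γ δ).toEmbedding (tens (tens x y) z) = tens x (tens y z) := by
  ext ⟨a, c, d⟩
  rw [embed_equiv_apply]
  simp [tens_apply, mul_assoc]

lemma embed_swapLast_tens (x : L2 α) (y : L2 γ) (z : L2 δ) :
    embed (swapLast α γ δ).toEmbedding (tens (tens x y) z) = tens (tens x z) y := by
  ext ⟨⟨a, d⟩, c⟩
  rw [embed_equiv_apply]
  simp [tens_apply, swapLast]
  ring

lemma trRight_marg_swapLast (ψ : L2 ((α × γ) × δ)) :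
    trRight (marg (embed (swapLast α γ δ).toEmbedding ψ)) = trRight (marg ψ) := by
  rw [trRight_marg, trRight_marg, ← marg_embed_env (Equiv.prodComm γ δ)]
  congr 1
  ext p
  simp only [embed_equiv_apply]
  rfl

lemma trLeft_marg_swapLast (ψ : L2 ((α × γ) × δ)) :
    trLeft (marg (embed (swapLast α γ δ).toEmbedding ψ))
      = marg (embed (Equiv.prodComm (α × γ) δ).toEmbedding ψ) := by
  rw [trLeft_marg]
  congr 1
  ext p
  simp only [embed_equiv_apply]
  rfl

lemma embed_swapLast_swapLast (ψ : L2 ((α × γ) × δ)) :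
    embed (swapLast α δ γ).toEmbedding (embed (swapLast α γ δ).toEmbedding ψ) = ψ := by
  ext p
  simp only [embed_equiv_apply]
  rfl

/-- The sum rule `I(A;C) + I(A;D) = 2 S(A)` for a pure state on `A C D`, normalised. -/
lemma relEntropy_add_relEntropy [Countable α] [Countable γ] [Countable δ]
    {ψ : L2 ((α × γ) × δ)} (hψ : ‖ψ‖ = 1) :
    relEntropy (marg ψ) (tensorOp (trRight (marg ψ)) (trLeft (marg ψ))) +
      relEntropy (marg (embed (swapLast α γ δ).toEmbedding ψ))
        (tensorOp (trRight (marg (embed (swapLast α γ δ).toEmbedding ψ)))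
          (trLeft (marg (embed (swapLast α γ δ).toEmbedding ψ))))
      = 2 * vonNeumannEntropy (trRight (marg ψ)) := by
  set ψ' := embed (swapLast α γ δ).toEmbedding ψ with hψ'
  set χA := embed (Equiv.prodAssoc α γ δ).toEmbedding ψ with hχA
  set χC := embed (Equiv.prodComm (α × δ) γ).toEmbedding ψ' with hχC
  set χD := embed (Equiv.prodComm (α × γ) δ).toEmbedding ψ with hχD
  have eA : trRight (marg ψ) = marg χA := trRight_marg ψ
  have eA' : trRight (marg ψ') = marg χA := (trRight_marg_swapLast ψ).trans eA
  have eD : trLeft (marg ψ') = marg χD := trLeft_marg_swapLast ψ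
  have eC : trLeft (marg ψ) = marg χC := by
    have := trLeft_marg_swapLast ψ'
    rwa [hψ', embed_swapLast_swapLast] at this
  rw [eA, eA', eC, eD]
  have innerA : ∀ x, ⟪embed (Equiv.prodAssoc α γ δ).toEmbedding x, χA⟫_ℂ = ⟪x, ψ⟫_ℂ := fun x =>
    LinearIsometry.inner_map_map _ _ _
  have contrC : ∀ y, contrL y χC = contrR y ψ' := fun y => contrL_embed_prodComm y ψ'
  have contrD : ∀ y, contrL y χD = contrR y ψ := fun y => contrL_embed_prodComm y ψ
  obtain ⟨sC⟩ := nonempty_spectralDecomposition_marg χC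
  obtain ⟨sD⟩ := nonempty_spectralDecomposition_marg χD
  have hne := nonempty_spectralDecomposition_marg χA
  suffices H : ∀ sA : SpectralDecomposition (marg χA),
      relEntropy (marg ψ) (tensorOp (marg χA) (marg χC)) +
        relEntropy (marg ψ') (tensorOp (marg χA) (marg χD))
        = 2 * ∑' k, ENNReal.ofReal (Real.negMulLog (sA.val k) / Real.log 2) by
    obtain ⟨sA⟩ := hne
    rw [vonNeumannEntropy, ENNReal.mul_iInf_of_ne (by simp) (by simp)]
    refine le_antisymm (le_iInf fun d => (H d).le) ((iInf_le _ sA).trans (H sA).ge)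
  intro sA
  set dA := sA.toEigenBasis
  set dC := sC.toEigenBasis
  set dD := sD.toEigenBasis
  have nA : ‖χA‖ = 1 := by rw [hχA, LinearIsometry.norm_map, hψ]
  have nC : ‖χC‖ = 1 := by rw [hχC, LinearIsometry.norm_map, hψ', LinearIsometry.norm_map, hψ]
  have nD : ‖χD‖ = 1 := by rw [hχD, LinearIsometry.norm_map, hψ]
  have sumA := dA.tsum_val
  have sumC := dC.tsum_val
  have sumD := dD.tsum_val
  rw [nA, one_pow, ENNReal.ofReal_one] at sumA
  rw [nC, one_pow, ENNReal.ofReal_one] at sumC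
  rw [nD, one_pow, ENNReal.ofReal_one] at sumD
  -- the joint distribution of the outcomes of measurements in the three local eigenbases
  let t : α → γ → δ → ℝ := fun k l i =>
    ‖⟪tens (tens (dA.vec k) (dC.vec l)) (dD.vec i), ψ⟫_ℂ‖ ^ 2
  have ht' : ∀ k l i, t k l i = ‖⟪tens (tens (dA.vec k) (dD.vec i)) (dC.vec l), ψ'⟫_ℂ‖ ^ 2 := by
    intro k l i
    rw [← embed_swapLast_tens, hψ', LinearIsometry.inner_map_map]
  have htA : ∀ k l i, t k l i
      = ‖⟪tens (dC.vec l) (dD.vec i), contrL (dA.vec k) χA⟫_ℂ‖ ^ 2 := by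
    intro k l i
    rw [inner_contrL, ← embed_prodAssoc_tens, innerA]
  -- an outcome with a marginal of probability zero has probability zero
  have zA : ∀ k l i, dA.val k = 0 → t k l i = 0 := by
    intro k l i h
    have h0 : contrL (dA.vec k) χA = 0 := by
      have := dA.val_eq_norm_sq k
      rw [h] at this
      exact norm_eq_zero.mp (pow_eq_zero_iff two_ne_zero |>.mp this.symm)
    rw [htA, h0]
    simp
  have zC : ∀ k l i, dC.val l = 0 → t k l i = 0 := by
    intro k l i h
    have h0 : contrR (dC.vec l) ψ' = 0 := by
      have := dC.val_eq_norm_sq l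
      rw [h, contrC] at this
      exact norm_eq_zero.mp (pow_eq_zero_iff two_ne_zero |>.mp this.symm)
    rw [ht', ← inner_contrR, h0]
    simp
  have zD : ∀ k l i, dD.val i = 0 → t k l i = 0 := by
    intro k l i h
    have h0 : contrR (dD.vec i) ψ = 0 := by
      have := dD.val_eq_norm_sq i
      rw [h, contrD] at this
      exact norm_eq_zero.mp (pow_eq_zero_iff two_ne_zero |>.mp this.symm)
    simp only [t]
    rw [← inner_contrR, h0]
    simp
  have tA : ∀ k, ∑' (l) (i), ENNReal.ofReal (t k l i) = ENNReal.ofReal (dA.val k) := by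
    intro k
    rw [dA.val_eq_norm_sq, ← tsum_ofReal_norm_inner_sq (tensBasis dC.vec dD.vec),
      ENNReal.tsum_prod']
    simp_rw [tensBasis_apply, htA]
  have a_le : ∀ k, dA.val k ≤ 1 := fun k => by
    have := ENNReal.le_tsum (f := fun k => ENNReal.ofReal (dA.val k)) k
    rw [sumA] at this
    exact ENNReal.ofReal_le_one.mp this
  obtain ⟨r, hr, hF⟩ := exists_relEntropy_eq ψ dA dC dA.val_nonneg sumA sumC dD t fun _ _ _ => rfl
  obtain ⟨r', hr', hF'⟩ := exists_relEntropy_eq ψ' dA dD dA.val_nonneg sumA sumD dC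
    (fun k i l => t k l i) fun k i l => ht' k l i
  simp_rw [ENNReal.tsum_comm (α := δ) (β := γ)] at hr' hF'
  have key : ∑' (k) (l) (i), (ENNReal.ofReal (t k l i / dD.val i) *
        relEntropyTerm (dD.val i) (dA.val k * dC.val l) +
      ENNReal.ofReal (t k l i / dC.val l) * relEntropyTerm (dC.val l) (dA.val k * dD.val i) +
        2 * (bitFactor * ENNReal.ofReal (t k l i)))
      = ∑' (k) (l) (i),
        (2 * (bitFactor * (ENNReal.ofReal (t k l i) * ENNReal.ofReal (-Real.log (dA.val k)))) +
        bitFactor * (ENNReal.ofReal (t k l i / dD.val i) * ENNReal.ofReal (dA.val k * dC.val l)) +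
        bitFactor *
          (ENNReal.ofReal (t k l i / dC.val l) * ENNReal.ofReal (dA.val k * dD.val i))) := by
    refine tsum_congr fun k => tsum_congr fun l => tsum_congr fun i => ?_
    exact relEntropyTerm_add_relEntropyTerm (sq_nonneg _) (dA.val_nonneg k) (a_le k)
      (dC.val_nonneg l) (dD.val_nonneg i) (zA k l i) (zC k l i) (zD k l i)
  simp_rw [ENNReal.tsum_add, ENNReal.tsum_mul_left, ENNReal.tsum_mul_right, tA, sumA] at key
  have hent : ∀ k, bitFactor * (ENNReal.ofReal (dA.val k) * ENNReal.ofReal (-Real.log (dA.val k)))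
      = ENNReal.ofReal (Real.negMulLog (sA.val k) / Real.log 2) := fun k => by
    have hL : 0 < Real.log 2 := Real.log_pos (by norm_num)
    rw [bitFactor, ← ENNReal.ofReal_mul (dA.val_nonneg k), ← ENNReal.ofReal_mul (by positivity),
      Real.negMulLog]
    congr 1
    change 1 / Real.log 2 * (sA.val k * -Real.log (sA.val k)) = _
    ring
  simp_rw [← hent, ENNReal.tsum_mul_left]
  -- after adding the total mass `1` of `t` twice, both sides become sums of nonnegative terms
  have hb : 2 * (bitFactor * 1) ≠ ⊤ := by simp [bitFactor, ENNReal.mul_eq_top]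
  refine (ENNReal.add_left_inj hb).mp ?_
  simp_rw [ENNReal.tsum_mul_right] at hr hr'
  have h1 := congrArg (bitFactor * ·) hr
  have h2 := congrArg (bitFactor * ·) hr'
  simp only [mul_add] at h1 h2
  have h3 : ∀ x a b c d e : ℝ≥0∞, a + c = e → b + d = e → a + b + (x + c + d) = x + 2 * e := by
    intro x a b c d e h h'
    rw [two_mul]
    nth_rewrite 1 [← h]
    rw [← h']
    ring
  rw [hF, hF', add_add_add_comm, add_assoc, key]
  exact h3 _ _ _ _ _ _ h1 h2

end SumRule

section Duality

variable {α β γ δ ε φ : Type*}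

lemma trRight_marg_smul (c : ℂ) (ψ : L2 ((α × γ) × δ)) :
    trRight (marg (c • ψ)) = ((‖c‖ ^ 2 : ℝ) : ℂ) • trRight (marg ψ) := by
  rw [trRight_marg, trRight_marg, map_smul, marg_smul]

lemma mutualInfo_marg (ψ : L2 ((α × γ) × δ)) :
    mutualInfo (marg ψ) = ENNReal.ofReal (‖ψ‖ ^ 2) *
      relEntropy (marg ((‖ψ‖⁻¹ : ℂ) • ψ)) (tensorOp (trRight (marg ((‖ψ‖⁻¹ : ℂ) • ψ)))
        (trLeft (marg ((‖ψ‖⁻¹ : ℂ) • ψ)))) := by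
  have h : marg ((‖ψ‖⁻¹ : ℂ) • ψ) = ((trace (marg ψ))⁻¹ : ℂ) • marg ψ := by
    rw [marg_smul, trace_marg]
    congr 1
    simp
  rw [h, mutualInfo, trace_marg]

/-- The sum rule `I(A;C) + I(A;D) = 2 S(A)` for a pure state on `A C D`. -/
lemma mutualInfo_add_mutualInfo [Countable α] [Countable γ] [Countable δ]
    (ψ : L2 ((α × γ) × δ)) :
    mutualInfo (marg ψ) + mutualInfo (marg (embed (swapLast α γ δ).toEmbedding ψ))
      = 2 * (ENNReal.ofReal (‖ψ‖ ^ 2) *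
        vonNeumannEntropy (((‖ψ‖⁻¹ ^ 2 : ℝ) : ℂ) • trRight (marg ψ))) := by
  by_cases hψ : ψ = 0
  · subst hψ
    simp [mutualInfo, trace_marg]
  have hn : ‖(‖ψ‖⁻¹ : ℂ) • ψ‖ = 1 := by
    rw [norm_smul]
    simp [hψ]
  have h := relEntropy_add_relEntropy hn
  rw [mutualInfo_marg, mutualInfo_marg, LinearIsometry.norm_map, ← mul_add,
    ← map_smul, h, trRight_marg_smul]
  simp
  ring

/-- The entropy of a finite-rank operator is finite. -/
lemma vonNeumannEntropy_ne_top {T : L2 α →L[ℂ] L2 α} (hT : Nonempty (SpectralDecomposition T))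
    (V : Submodule ℂ (L2 α)) [FiniteDimensional ℂ V] (hV : ∀ x, T x ∈ V) :
    vonNeumannEntropy T ≠ ⊤ := by
  obtain ⟨d⟩ := hT
  refine ne_top_of_le_ne_top ?_ (iInf_le _ d)
  have hmem : ∀ k : {k // d.val k ≠ 0}, d.vec k ∈ V := fun k => by
    have h := V.smul_mem (d.val k : ℂ)⁻¹ (hV (d.vec k))
    rwa [d.apply_vec, smul_smul, inv_mul_cancel₀ (by exact_mod_cast k.2), one_smul] at h
  have hli : LinearIndependent ℂ fun k : {k // d.val k ≠ 0} => (⟨d.vec k, hmem k⟩ : V) := by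
    refine LinearIndependent.of_comp V.subtype ?_
    exact d.vec.orthonormal.linearIndependent.comp _ Subtype.val_injective
  have hfin' : Finite {k // d.val k ≠ 0} := hli.finite
  have hfin : {k | d.val k ≠ 0}.Finite := hfin'
  rw [tsum_eq_sum (s := hfin.toFinset)]
  · exact ENNReal.sum_ne_top.mpr fun _ _ => ENNReal.ofReal_ne_top
  · intro k hk
    have : d.val k = 0 := by simpa using hk
    simp [this]

/-! ### Duality of the conditional mutual information -/

/-- The exchange `(A B E) F ≃ (A B F) E`. -/
def swapInner (α β ε φ : Type*) : (α × β × ε) × φ ≃ (α × β × φ) × ε where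
  toFun x := ((x.1.1, x.1.2.1, x.2), x.1.2.2)
  invFun x := ((x.1.1, x.1.2.1, x.2), x.1.2.2)
  left_inv _ := rfl
  right_inv _ := rfl

lemma embed_swapInner_swapInner (ψ : L2 ((α × β × ε) × φ)) :
    embed (swapInner α β φ ε).toEmbedding (embed (swapInner α β ε φ).toEmbedding ψ) = ψ := by
  ext p
  simp only [embed_equiv_apply]
  rfl

lemma trMiddle_marg (ψ : L2 ((α × β × ε) × φ)) :
    trMiddle (marg ψ) = marg (embed (swapLast α (β × φ) ε).toEmbedding
      (embed (swapInner α β ε φ).toEmbedding ψ)) := by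
  rw [trMiddle, reindexOp_marg, trRight_marg]
  congr 1
  ext p
  simp only [embed_equiv_apply]
  rfl

lemma trRight_marg_swapInner (ψ : L2 ((α × β × ε) × φ)) :
    trRight (marg (embed (swapInner α β ε φ).toEmbedding ψ)) = trRight (marg ψ) := by
  rw [trRight_marg, trRight_marg, ← marg_embed_env (R := (β × ε) × φ) (R' := (β × φ) × ε)
    ⟨fun x => ((x.1.1, x.2), x.1.2), fun x => ((x.1.1, x.2), x.1.2), fun _ => rfl, fun _ => rfl⟩]
  congr 1
  ext p
  simp only [embed_equiv_apply]
  rfl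

/-- Operators on `A` commute with the exchange of `E` and `F`. -/
lemma leftOp_swapInner (P : L2 α →L[ℂ] L2 α) (ψ : L2 ((α × β × ε) × φ)) :
    leftOp ε (leftOp (β × φ) P) (embed (swapInner α β ε φ).toEmbedding ψ)
      = embed (swapInner α β ε φ).toEmbedding (leftOp φ (leftOp (β × ε) P) ψ) := by
  ext ⟨⟨a, b, f⟩, e⟩
  have h : slice (b, f) (slice e (embed (swapInner α β ε φ).toEmbedding ψ))
      = slice (b, e) (slice f ψ) := by
    ext a
    simp only [slice_apply, embed_equiv_apply]
    rfl
  rw [leftOp_apply, leftOp_apply, h, embed_equiv_apply]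
  change _ = leftOp φ (leftOp (β × ε) P) ψ ((a, b, e), f)
  rw [leftOp_apply, leftOp_apply]

/-- The identity `I(A;BE) - I(A;E) = I(A;BF) - I(A;F)` for a vector in `A B E F` whose marginal on
`A` has finite rank, where both `I(A;BE) + I(A;F)` and `I(A;BF) + I(A;E)` are equal to `2 S(A)`. -/
lemma mutualInfo_sub_mutualInfo [Countable α] [Countable β] [Countable ε] [Countable φ]
    (χ : L2 ((α × β × ε) × φ)) (V : Submodule ℂ (L2 α)) [FiniteDimensional ℂ V]
    (hV : ∀ x, trRight (marg χ) x ∈ V) :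
    mutualInfo (marg χ) - mutualInfo (trMiddle (marg χ))
      = mutualInfo (marg (embed (swapInner α β ε φ).toEmbedding χ))
        - mutualInfo (trMiddle (marg (embed (swapInner α β ε φ).toEmbedding χ))) := by
  have h1 := mutualInfo_add_mutualInfo χ
  have h2 := mutualInfo_add_mutualInfo (embed (swapInner α β ε φ).toEmbedding χ)
  rw [trRight_marg_swapInner, LinearIsometry.norm_map, ← h1] at h2
  have hfin : mutualInfo (marg χ) + mutualInfo (marg (embed (swapLast α (β × ε) φ).toEmbedding χ))
      ≠ ⊤ := by
    rw [h1]
    refine ENNReal.mul_ne_top (by simp) (ENNReal.mul_ne_top ENNReal.ofReal_ne_top ?_)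
    refine vonNeumannEntropy_ne_top ?_ V fun x => V.smul_mem _ (hV x)
    have := trRight_marg_smul ((‖χ‖⁻¹ : ℝ) : ℂ) χ
    rw [Complex.norm_real, norm_inv, norm_norm] at this
    rw [← this, trRight_marg]
    exact nonempty_spectralDecomposition_marg _
  rw [trMiddle_marg, trMiddle_marg, embed_swapInner_swapInner]
  rw [ENNReal.add_ne_top] at hfin
  have hfin' : mutualInfo (marg (embed (swapLast α (β × φ) ε).toEmbedding
      (embed (swapInner α β ε φ).toEmbedding χ))) ≠ ⊤ := by
    refine ne_top_of_le_ne_top (ENNReal.add_ne_top.mpr hfin) ?_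
    rw [← h2]
    exact le_add_self
  -- with `x + y' = y + x'` finite, `x - x' = y - y'` holds also for the truncated subtraction
  rw [← ENNReal.add_sub_add_eq_sub_right hfin.2, ← h2, add_comm _ (mutualInfo (marg (embed
    (swapLast α (β × φ) ε).toEmbedding _))), ENNReal.add_sub_add_eq_sub_left hfin']

/-- Duality of the conditional mutual information: `I(A;B|E) = I(A;B|F)` for a pure state on
`A B E F`. -/
lemma condMutualInfo_marg_swapInner [Countable α] [Countable β] [Countable ε] [Countable φ]
    (ψ : L2 ((α × β × ε) × φ)) :
    condMutualInfo (marg (embed (swapInner α β ε φ).toEmbedding ψ)) = condMutualInfo (marg ψ) := by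
  refine iSup_congr fun P => iSup_congr fun hP => iSup_congr fun hfin => ?_
  have hadj : P.adjoint = P := hP.isSelfAdjoint
  have hQ' : (leftOp (β × ε) P).adjoint = leftOp (β × ε) P := by rw [adjoint_leftOp, hadj]
  have hQ'' : (leftOp (β × φ) P).adjoint = leftOp (β × φ) P := by rw [adjoint_leftOp, hadj]
  simp only
  rw [leftOp_comp_marg_comp _ hQ', leftOp_comp_marg_comp _ hQ'', leftOp_swapInner]
  refine (mutualInfo_sub_mutualInfo _ P.range fun x => ?_).symm
  have h : embed (Equiv.prodAssoc α (β × ε) φ).toEmbedding (leftOp φ (leftOp (β × ε) P) ψ)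
      = leftOp ((β × ε) × φ) P (embed (Equiv.prodAssoc α (β × ε) φ).toEmbedding ψ) := by
    ext ⟨a, be, f⟩
    have hs : slice (be, f) (embed (Equiv.prodAssoc α (β × ε) φ).toEmbedding ψ)
        = slice be (slice f ψ) := by
      ext a
      simp only [slice_apply, embed_equiv_apply]
      rfl
    rw [embed_equiv_apply]
    change leftOp φ (leftOp (β × ε) P) ψ ((a, be), f) = _
    rw [leftOp_apply, leftOp_apply, leftOp_apply, hs]
  rw [trRight_marg, h, ← leftOp_comp_marg_comp P hadj]
  exact ⟨_, rfl⟩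

end Duality

/-! ### Purification -/

section Purification

variable {X : Type*}

lemma IsDensityOperator.hasSum_ket {ω : L2 X →L[ℂ] L2 X} (hω : IsDensityOperator ω) :
    HasSum (fun x => ⟪(ket x : L2 X), ω (ket x)⟫_ℂ) 1 := by
  have hinj : Function.Injective (ket : X → L2 X) := ket.orthonormal.linearIndependent.injective
  have h := hω.2 (Set.range (ket : X → L2 X))
    (HilbertBasis.mk (v := ((↑) : Set.range (ket : X → L2 X) → L2 X))
      ket.orthonormal.toSubtypeRange (by rw [Subtype.range_coe, ket.dense_span]))
  rw [HilbertBasis.coe_mk] at h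
  exact (Equiv.ofInjective _ hinj).hasSum_iff.mpr h

/-- A self-adjoint square root of a positive operator. -/
lemma exists_sqrt_of_isPositive {E : Type*} [NormedAddCommGroup E]
    [InnerProductSpace ℂ E] [CompleteSpace E] {T : E →L[ℂ] E} (hT : T.IsPositive) :
    ∃ C : E →L[ℂ] E, (∀ x y, ⟪C x, y⟫_ℂ = ⟪x, C y⟫_ℂ) ∧ ∀ x, C (C x) = T x :=
  ⟨CFC.sqrt T, ((ContinuousLinearMap.nonneg_iff_isPositive _).mp (CFC.sqrt_nonneg T)).1, fun x =>
    congrArg (fun T : E →L[ℂ] E => T x)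
      (CFC.sqrt_mul_sqrt_self T ((ContinuousLinearMap.nonneg_iff_isPositive T).mpr hT))⟩

/-- Every density operator on `ℓ²(X)`, `X` countable, is a marginal of a pure state. The
purification is made of the columns of the square root. -/
lemma IsDensityOperator.exists_marg_eq [Countable X] {ω : L2 X →L[ℂ] L2 X}
    (hω : IsDensityOperator ω) : ∃ ψ : L2 (X × ℕ), ‖ψ‖ = 1 ∧ marg ψ = ω := by
  obtain ⟨enc, henc⟩ := exists_injective_nat X
  obtain ⟨C, hCs, hCC⟩ := exists_sqrt_of_isPositive hω.1
  let v : ℕ → L2 X := Function.extend enc (fun x => C (ket x)) 0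
  have hsum : HasSum (fun n => ‖v n‖ ^ 2) 1 := by
    have h := hω.hasSum_ket.mapL Complex.reCLM
    have h2 : HasSum (fun x => ‖C (ket x)‖ ^ 2) 1 := by
      refine (h.congr_fun fun x => ?_).trans_eq (by simp)
      rw [← hCC, ← hCs, inner_self_eq_norm_sq_to_K]
      simp [← Complex.ofReal_pow]
    have h3 := (hasSum_extend_zero henc).mpr h2
    refine h3.congr_fun fun n => ?_
    by_cases hn : ∃ x, enc x = n
    · obtain ⟨x, rfl⟩ := hn
      simp only [v, henc.extend_apply]
    · simp only [v, Function.extend_apply' _ _ _ hn]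
      simp
  let V : lp (fun _ : ℕ => L2 X) 2 := ⟨v, memℓp_gen (by simpa using hsum.summable)⟩
  have hslice : ∀ n, slice n (directSumIso X ℕ V) = v n := fun n => by
    ext x
    rw [slice_apply, directSumIso_apply]
  refine ⟨directSumIso X ℕ V, ?_, ?_⟩
  · have h := hasSum_norm_slice_sq (directSumIso X ℕ V)
    simp_rw [hslice] at h
    exact (pow_eq_one_iff_of_nonneg (norm_nonneg _) two_ne_zero).mp (h.unique hsum)
  · refine ContinuousLinearMap.ext fun y => ext_inner_left ℂ fun x => ?_
    have h := ((hasSum_marg (directSumIso X ℕ V)).mapL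
      (ContinuousLinearMap.apply ℂ (L2 X) y)).mapL (innerSL ℂ x)
    have h2 := (hasSum_extend_zero henc).mpr ((ket (ι := X)).hasSum_inner_mul_inner (C x) (C y))
    rw [hCs, hCC] at h2
    refine h.unique (h2.congr_fun fun n => ?_)
    rw [hslice]
    by_cases hn : ∃ x, enc x = n
    · obtain ⟨z, rfl⟩ := hn
      simp only [v, henc.extend_apply]
      simp [hCs, mul_comm]
    · simp only [v, Function.extend_apply' _ _ _ hn]
      simp

end Purification

/-! ### Total and dual total correlation -/

section Multipartite

variable {m : ℕ} {ι : Fin m → Type*} {ε φ : Type*}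

lemma embed_embed {α β γ : Type*} (e : α ≃ β) (e' : β ≃ γ) (ψ : L2 α) :
    embed e'.toEmbedding (embed e.toEmbedding ψ) = embed (e.trans e').toEmbedding ψ := by
  ext c
  simp only [embed_equiv_apply]
  rfl

variable [∀ j, Countable (ι j)] [Countable ε] [Countable φ]

/-- For a pure state on `A_1 ⋯ A_m E F`, conditioning on `E` in the `i`-th term of the total
correlation is dual to conditioning on the complementary system `A_{i+1} ⋯ A_m F`. -/
lemma totalTerm_marg (ψ : L2 (((∀ j, ι j) × ε) × φ)) (i : Fin m) :
    totalTerm (marg ψ) i = dualTerm (marg (embed (swapLast _ ε φ).toEmbedding ψ)) i := by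
  rw [totalTerm, dualTerm, reindexOp_marg, trRight_marg, reindexOp_marg,
    ← condMutualInfo_marg_swapInner, embed_embed, embed_embed, embed_embed]
  congr 3

lemma condTotalCorrelation_marg (ψ : L2 (((∀ j, ι j) × ε) × φ)) :
    condTotalCorrelation (marg ψ)
      = condDualTotalCorrelation (marg (embed (swapLast _ ε φ).toEmbedding ψ)) :=
  Finset.sum_congr rfl fun i _ => totalTerm_marg ψ i

lemma condDualTotalCorrelation_marg (ψ : L2 (((∀ j, ι j) × ε) × φ)) :
    condDualTotalCorrelation (marg ψ)
      = condTotalCorrelation (marg (embed (swapLast _ ε φ).toEmbedding ψ)) := by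
  rw [condTotalCorrelation_marg, embed_swapLast_swapLast]

/-- The complementary extension: the marginal of a purification that keeps the purifying system in
place of `E`. -/
lemma IsExtension.exists_complementary {ρ : L2 (∀ j, ι j) →L[ℂ] L2 (∀ j, ι j)}
    {ω : L2 ((∀ j, ι j) × ε) →L[ℂ] L2 ((∀ j, ι j) × ε)} (hω : IsExtension ρ ω) :
    ∃ ω' : L2 ((∀ j, ι j) × ℕ) →L[ℂ] L2 ((∀ j, ι j) × ℕ), IsExtension ρ ω' ∧
      condTotalCorrelation ω' = condDualTotalCorrelation ω ∧
      condDualTotalCorrelation ω' = condTotalCorrelation ω := by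
  obtain ⟨ψ, hψ, rfl⟩ := hω.1.exists_marg_eq
  refine ⟨marg (embed (swapLast _ ε ℕ).toEmbedding ψ), ⟨isDensityOperator_marg ?_, ?_⟩,
    (condDualTotalCorrelation_marg ψ).symm, (condTotalCorrelation_marg ψ).symm⟩
  · rw [LinearIsometry.norm_map, hψ]
  · rw [trRight_marg_swapLast, hω.2]

end Multipartite

end QuantumInfo

theorem mainTheorem4 {m : ℕ} (H : Fin m → Type*)
    [∀ i, NormedAddCommGroup (H i)] [∀ i, InnerProductSpace ℂ (H i)]
    [∀ i, CompleteSpace (H i)] [∀ i, TopologicalSpace.SeparableSpace (H i)]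
    (K : Type*) [NormedAddCommGroup K] [InnerProductSpace ℂ K] [CompleteSpace K]
    (t : MultilinearMap ℂ H K) (ht : QuantumInfo.IsHilbertTensorProduct t)
    (ρ : K →L[ℂ] K) (hρ : QuantumInfo.IsDensityOperator ρ) :
    QuantumInfo.squashedEntanglement ht ρ = QuantumInfo.dualSquashedEntanglement ht ρ := by
  have hc : ∀ i, Countable (QuantumInfo.BasisIndex (H i)) := fun i =>
    QuantumInfo.countable_basisIndex (H i)
  rw [QuantumInfo.squashedEntanglement, QuantumInfo.dualSquashedEntanglement]
  congr 1
  refine le_antisymm ?_ ?_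
  · refine le_iInf fun ε => le_iInf fun hε => le_iInf fun ω => le_iInf fun hω => ?_
    obtain ⟨ω', h, h1, -⟩ := hω.exists_complementary
    rw [← h1]
    exact iInf_le_of_le ℕ <| iInf_le_of_le inferInstance <| iInf_le_of_le ω' <| iInf_le _ h
  · refine le_iInf fun ε => le_iInf fun hε => le_iInf fun ω => le_iInf fun hω => ?_
    obtain ⟨ω', h, -, h2⟩ := hω.exists_complementary
    rw [← h2]
    exact iInf_le_of_le ℕ <| iInf_le_of_le inferInstance <| iInf_le_of_le ω' <| iInf_le _ h
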